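/- Let $n\ge 2$, $I=\{0,1,\dots,n-1\}$ (identified with $\mathbb{Z}/n$), and let $P_{\rm cl}=\bigoplus_{i\in I}\mathbb{Z}\Lambda_i$ be the classical weight lattice of type $A_{n-1}^{(1)}$, with simple coroots $h_i$, simple roots $\alpha_i$, and $\epsilon_a=\Lambda_a-\Lambda_{a-1}$ $(a\in\mathbb{Z}/n)$. Let $1\le r\le n-1$ and $s\ge 1$. Let $\mathbf{B}^{r,s}$ be the Kirillov--Reshetikhin crystal of type $A_{n-1}^{(1)}$, that is (up to isomorphism) the regular $U_q'(A_{n-1}^{(1)})$-crystal which, as a crystal for the colors $I\setminus\{0\}$, is isomorphic to the crystal $\mathbf{B}(s\omega_r)$ of semistandard tableaux of shape $(s^r)$ with entries in $\{1,\dots,n\}$. Here a crystal is regular if for every proper subset $J\subset I$ with $|J|\le 2$ it is isomorphic, as a crystal for the colors in $J$, to the crystal base of an integrable $U_q(\mathfrak{g}_J)$-module. For $1\le k\le n-1$ let $\eta_k$ be the Lusztig involution on $\mathbf{B}^{r,s}$ regarded as a crystal for $\mathfrak{g}_{I\setminus\{0,k\}}\simeq A_{k-1}\oplus A_{n-k-1}$,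 that is, the map $\eta_k:\mathbf{B}^{r,s}\to\mathbf{B}^{r,s}$ (extended by $\eta_k(\mathbf{0})=\mathbf{0}$) such that for all $b$ 1. $\eta_k^2(b)=b$; 2. ${\rm wt}(\eta_k(b))=w_0({\rm wt}(b))$, where $w_0$ is the longest element of the Weyl group of $\mathfrak{g}_{I\setminus\{0,k\}}$, so that $w_0(\epsilon_a)=\epsilon_{k+1-a}$ with indices modulo $n$; 3. $\eta_k(\widetilde e_i b)=\widetilde f_{k-i}(\eta_k(b))$ and $\eta_k(\widetilde f_i b)=\widetilde e_{k-i}(\eta_k(b))$ for $i\in I\setminus\{0,k\}$, with indices modulo $n$. Then for every $1\le k\le n-1$ there is exactly one map $\eta_k$ with these properties, and on $\mathbf{B}^{r,s}$ $$\widetilde e_0=\eta_k\circ\widetilde f_k\circ\eta_k,\qquad \widetilde f_0=\eta_k\circ\widetilde e_k\circ\eta_k .$$ -/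

import Mathlib

/-! Crystals of type `A_{n-1}^{(1)}`. The index set `I = {0, 1, ..., n-1}` of simple roots is `ZMod n`,
and the weight lattice `P_cl = ⨁ ℤ Λ_i` is `ZMod n → ℤ`, a weight `lam` being given by its pairings
`lam i = ⟨lam, h_i⟩` with the simple coroots. The formal symbol `0` is `none`. -/

/-- The simple root `α_j`, given by the column `j` of the Cartan matrix of type `A_{n-1}^{(1)}`
(for `n = 2` the off-diagonal entries are `-2`). -/
def simpleRoot (n : ℕ) (j : ZMod n) : ZMod n → ℤ := fun i =>
  2 * (if i = j then 1 else 0) - (if i = j + 1 then 1 else 0) - (if i = j - 1 then 1 else 0)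

/-- The underlying maps of a crystal, no axioms being imposed. -/
structure CrystalData (n : ℕ) (B : Type*) where
  wt : B → ZMod n → ℤ
  ε : ZMod n → B → WithBot ℤ
  φ : ZMod n → B → WithBot ℤ
  e : ZMod n → B → Option B
  f : ZMod n → B → Option B

/-- The axioms of a `U'_q(A_{n-1}^{(1)})`-crystal. -/
structure IsCrystal {n : ℕ} {B : Type*} (X : CrystalData n B) : Prop where
  phi_eq : ∀ i b, X.φ i b = (X.wt b i : WithBot ℤ) + X.ε i b
  eps_e : ∀ i b b', X.e i b = some b' → X.ε i b = X.ε i b' + 1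
  phi_e : ∀ i b b', X.e i b = some b' → X.φ i b' = X.φ i b + 1
  wt_e : ∀ i b b', X.e i b = some b' → X.wt b' = X.wt b + simpleRoot n i
  eps_f : ∀ i b b', X.f i b = some b' → X.ε i b' = X.ε i b + 1
  phi_f : ∀ i b b', X.f i b = some b' → X.φ i b = X.φ i b' + 1
  wt_f : ∀ i b b', X.f i b = some b' → X.wt b' = X.wt b - simpleRoot n i
  f_iff_e : ∀ i b b', X.f i b = some b' ↔ X.e i b' = some b
  bot : ∀ i b, X.φ i b = ⊥ → X.e i b = none ∧ X.f i b = none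

/-! ### Words

The letters `1, ..., n` are the classes in `ZMod n` (so that `n` is the class `0`). They form the
crystal with arrows `i → i + 1` of color `i`; for `i ≠ 0` this is the crystal `[n]` of the natural
representation of `A_{n-1}`, and the arrow of color `0` is `n → 1`. -/

/-- The weight `ε_a = Λ_a - Λ_{a-1}` of the letter `a`. -/
def letterWt (n : ℕ) (a : ZMod n) : ZMod n → ℤ := fun i =>
  (if i = a then 1 else 0) - (if i = a - 1 then 1 else 0)

/-- `ε_i` of a letter. -/
def letterEps (n : ℕ) (i a : ZMod n) : ℤ := if a = i + 1 then 1 else 0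

/-- `φ_i` of a letter. -/
def letterPhi (n : ℕ) (i a : ZMod n) : ℤ := if a = i then 1 else 0

/-- `e_i` on letters: `i + 1 ↦ i`. -/
def letterE (n : ℕ) (i a : ZMod n) : Option (ZMod n) := if a = i + 1 then some i else none

/-- `f_i` on letters: `i ↦ i + 1`. -/
def letterF (n : ℕ) (i a : ZMod n) : Option (ZMod n) := if a = i then some (i + 1) else none

/-- The weight of a word `w_1 ⊗ ⋯ ⊗ w_m`. -/
def wordWt (n : ℕ) : List (ZMod n) → ZMod n → ℤ
  | [] => 0
  | a :: w => letterWt n a + wordWt n w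

/-- `ε_i` of a word, by the tensor product rule. -/
def wordEps (n : ℕ) (i : ZMod n) : List (ZMod n) → ℤ
  | [] => 0
  | a :: w => max (letterEps n i a) (wordEps n i w - letterWt n a i)

/-- `φ_i` of a word, by the tensor product rule. -/
def wordPhi (n : ℕ) (i : ZMod n) : List (ZMod n) → ℤ
  | [] => 0
  | a :: w => max (letterPhi n i a + wordWt n w i) (wordPhi n i w)

/-- `e_i` on words: `e_i (b₁ ⊗ b₂)` is `e_i b₁ ⊗ b₂` if `φ_i b₁ ≥ ε_i b₂`, and `b₁ ⊗ e_i b₂`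
otherwise. -/
def wordE (n : ℕ) (i : ZMod n) : List (ZMod n) → Option (List (ZMod n))
  | [] => none
  | a :: w =>
    if wordEps n i w ≤ letterPhi n i a then (letterE n i a).map (fun a' => a' :: w)
    else (wordE n i w).map (fun w' => a :: w')

/-- `f_i` on words: `f_i (b₁ ⊗ b₂)` is `f_i b₁ ⊗ b₂` if `φ_i b₁ > ε_i b₂`, and `b₁ ⊗ f_i b₂`
otherwise. -/
def wordF (n : ℕ) (i : ZMod n) : List (ZMod n) → Option (List (ZMod n))
  | [] => none
  | a :: w =>
    if wordEps n i w < letterPhi n i a then (letterF n i a).map (fun a' => a' :: w)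
    else (wordF n i w).map (fun w' => a :: w')

/-- The crystal of finite words, the disjoint union of the tensor powers of the crystal of letters. -/
def wordCrystal (n : ℕ) : CrystalData n (List (ZMod n)) where
  wt := wordWt n
  ε := fun i w => (wordEps n i w : WithBot ℤ)
  φ := fun i w => (wordPhi n i w : WithBot ℤ)
  e := wordE n
  f := wordF n

/-! ### Isomorphisms, regularity -/

/-- The connected component of `b` in the graph formed by the arrows of colors in `J`. -/
def component {n : ℕ} {B : Type*} (X : CrystalData n B) (J : Set (ZMod n)) (b : B) : Set B :=
  {b' | Relation.EqvGen (fun x y => ∃ i ∈ J, X.f i x = some y) b b'}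

/-- For a set `S` that is a union of connected components for the colors in `J`, the map `ψ` is an
isomorphism of crystals for the colors in `J` from `S` onto a union of connected components of `Y`,
after all weights of `S` have been shifted by `mu`. -/
structure IsCrystalEmbeddingOn {n : ℕ} {B C : Type*} (J : Set (ZMod n)) (mu : ZMod n → ℤ)
    (X : CrystalData n B) (S : Set B) (Y : CrystalData n C) (ψ : B → C) : Prop where
  injOn : Set.InjOn ψ S
  wt : ∀ b ∈ S, Y.wt (ψ b) = X.wt b + mu
  ε : ∀ i ∈ J, ∀ b ∈ S, Y.ε i (ψ b) = X.ε i b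
  φ : ∀ i ∈ J, ∀ b ∈ S, Y.φ i (ψ b) = X.φ i b
  e : ∀ i ∈ J, ∀ b ∈ S, Y.e i (ψ b) = (X.e i b).map ψ
  f : ∀ i ∈ J, ∀ b ∈ S, Y.f i (ψ b) = (X.f i b).map ψ

/-- For a proper subset `J` of `I` with at most two elements, `X` is, with respect to the colors in
`J`, isomorphic to the crystal base of an integrable `U_q(g_J)`-module. Such a crystal is a disjoint
union of crystals `B_J(lam)` of irreducible highest weight modules, `lam` in `P_cl` being dominant
for `J`. Here `g_J` is of type `A_1`, `A_1 × A_1` or `A_2`, and the `B_J(lam)` are, up to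
isomorphism, exactly the connected components of the crystal of words, with weights shifted by some
`mu` that is orthogonal to the coroots `h_i` with `i ∈ J`. -/
def IsIntegrable {n : ℕ} {B : Type*} (X : CrystalData n B) (J : Set (ZMod n)) : Prop :=
  ∀ b : B, ∃ (mu : ZMod n → ℤ) (ψ : B → List (ZMod n)), (∀ i ∈ J, mu i = 0) ∧
    IsCrystalEmbeddingOn J mu X (component X J b) (wordCrystal n) ψ

/-- A crystal is regular if for every proper subset `J` of `I` with at most two elements it is
isomorphic, as a crystal for `g_J`, to the crystal base of an integrable `U_q(g_J)`-module. -/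
def IsRegularCrystal {n : ℕ} {B : Type*} (X : CrystalData n B) : Prop :=
  ∀ i j : ZMod n, ({i, j} : Set (ZMod n)) ≠ Set.univ → IsIntegrable X {i, j}

/-! ### The classical crystal `B(s ω_r)` of semistandard tableaux -/

/-- The rectangular Young diagram `(s^r)` with `r` rows of length `s`. -/
def rectDiagram (r s : ℕ) : YoungDiagram where
  cells := Finset.range r ×ˢ Finset.range s
  isLowerSet := by
    rintro ⟨a, b⟩ ⟨c, d⟩ ⟨h₁, h₂⟩ h
    simp only [Finset.coe_product, Finset.coe_range, Set.mem_prod, Set.mem_Iio] at h ⊢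
    exact ⟨lt_of_le_of_lt h₁ h.1, lt_of_le_of_lt h₂ h.2⟩

/-- `SST_{[n]}((s^r))`: semistandard tableaux of shape `(s^r)` with entries in `{1, ..., n}`. -/
def RectTableau (n r s : ℕ) : Type :=
  {T : SemistandardYoungTableau (rectDiagram r s) // ∀ i < r, ∀ j < s, 1 ≤ T i j ∧ T i j ≤ n}

/-- The word of a tableau: rows from top to bottom, each of them from right to left. -/
def readingWord {n r s : ℕ} (T : RectTableau n r s) : List (ZMod n) :=
  (List.range r).flatMap fun i =>
    (List.range s).reverse.map fun j => ((T.val i j : ℕ) : ZMod n)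

/-- `X` is a KR crystal `B^{r,s}` of type `A_{n-1}^{(1)}`: a regular `U'_q(A_{n-1}^{(1)})`-crystal
which, as a crystal for the colors `I \ {0}`, is isomorphic to the crystal `B(s ω_r)` of semistandard
tableaux of shape `(s^r)`. -/
structure IsKRCrystal {n : ℕ} {B : Type*} (r s : ℕ) (X : CrystalData n B) : Prop where
  isCrystal : IsCrystal X
  isRegular : IsRegularCrystal X
  classical : ∃ ψ : B → List (ZMod n),
    IsCrystalEmbeddingOn {i | i ≠ 0} 0 X Set.univ (wordCrystal n) ψ ∧
      Set.range ψ = Set.range (readingWord : RectTableau n r s → List (ZMod n))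

/-! ### The involution `η_k` -/

/-- The action on weights of level zero of the longest element `w_0` of the Weyl group of
`g_{I \ {0,k}}`, of type `A_{k-1} ⊕ A_{n-k-1}`. It reverses `1, ..., k` and reverses `k+1, ..., n`,
that is, `w_0 ε_a = ε_{k+1-a}` for `a` in `ZMod n` (see `longestWeyl_letterWt`). -/
def longestWeyl (n : ℕ) (k : ZMod n) : (ZMod n → ℤ) →+ (ZMod n → ℤ) where
  toFun := fun lam i => -lam (k - i)
  map_zero' := by ext i; simp
  map_add' := by intro x y; ext i; simp; ring

theorem longestWeyl_letterWt (n : ℕ) (k a : ZMod n) :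
    longestWeyl n k (letterWt n a) = letterWt n (k + 1 - a) := by
  ext i
  have h₁ : k - i = a ↔ i = k + 1 - a - 1 := by
    constructor <;> intro h
    · rw [← h]; ring
    · rw [h]; ring
  have h₂ : k - i = a - 1 ↔ i = k + 1 - a := by
    constructor <;> intro h
    · rw [show a = k - i + 1 by rw [h]; ring]; ring
    · rw [h]; ring
  simp only [longestWeyl, letterWt, AddMonoidHom.coe_mk, ZeroHom.coe_mk, h₁, h₂]
  ring

/-- `η` is the Lusztig involution `η_k` of `X` as a crystal for the colors `I \ {0,k}`. The diagram
involution is `i ↦ k - i` for `i = 1, ..., k - 1` and `i ↦ n + k - i` for `i = k + 1, ..., n - 1`. -/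
structure IsLusztigInvolution {n : ℕ} {B : Type*} (X : CrystalData n B) (k : ZMod n)
    (η : B → B) : Prop where
  invol : ∀ b, η (η b) = b
  wt : ∀ b, X.wt (η b) = longestWeyl n k (X.wt b)
  e : ∀ i, i ≠ 0 → i ≠ k → ∀ b, (X.e i b).map η = X.f (k - i) (η b)
  f : ∀ i, i ≠ 0 → i ≠ k → ∀ b, (X.f i b).map η = X.e (k - i) (η b)

/-!
The idea is that the reflection `i ↦ k - i` of the affine Dynkin diagram lifts to a map `θ` of the
whole crystal that exchanges raising and lowering operators, and that this `θ` is the Lusztig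
involution.

Consider `X` with the colors other than `0`, and the dual of `X` with the colors other than `k`,
relabelled by `i ↦ k - i`. Both are crystals of type `A_{n-1}`, regular in rank two. By Stembridge's
uniqueness theorem (`IsStembridge.exists_hom`), a connected crystal of this kind is determined by
the weight of its highest weight element. The first crystal is generated by the tableau with content
`{1, ..., r}`, and in the second one the tableau with content `{k + 1 - r, ..., k}` modulo `n` has
highest weight for reasons of weight (`IsKRCrystal.exists_extremal`). Hence there is a map `θ` with
`θ e_i = f_{k-i} θ` and `θ f_i = e_{k-i} θ` for all `i ≠ 0`, the color `k` included.

The restriction of `X` to the colors other than `0` and `k` is multiplicity free: a highest weight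
tableau is determined by its content (`readingWord_eq_of_count_eq`), and the content is determined
by the weight. So an endomorphism for these colors is the identity (`IsKRCrystal.eq_self_of_comm`).
This applies to `θ ∘ θ` and to `θ ∘ η` for every Lusztig involution `η`; it follows that `θ` is the
only Lusztig involution. The relations for the color `k` now read `θ f_k θ = e_0` and
`θ e_k θ = f_0`.

The hypotheses of Stembridge's theorem concern two colors. Regularity reduces them to words, where
they are proved by induction on the length (`isLocalA2At_word`). For this induction the axioms are
stated for raising operators only; those for lowering operators are formal consequences
(`IsSeminormal.down_square`, `IsSeminormal.down_octagon`).
-/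

/-! ### The tensor product rule on words -/

theorem letterPhi_sub_letterEps (n : ℕ) (i a : ZMod n) :
    letterPhi n i a - letterEps n i a = letterWt n a i := by
  simp only [letterPhi, letterEps, letterWt, eq_comm (a := a), eq_sub_iff_add_eq]

theorem wordEps_nonneg (n : ℕ) (i : ZMod n) (w : List (ZMod n)) : 0 ≤ wordEps n i w := by
  cases w with
  | nil => simp [wordEps]
  | cons a w => simp only [wordEps, letterEps]; split_ifs <;> simp

theorem wordPhi_eq (n : ℕ) (i : ZMod n) (w : List (ZMod n)) :
    wordPhi n i w = wordWt n w i + wordEps n i w := by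
  induction w with
  | nil => simp [wordPhi, wordEps, wordWt]
  | cons a w ih =>
    have h := letterPhi_sub_letterEps n i a
    simp only [wordPhi, wordEps, wordWt, Pi.add_apply, ih]
    omega

theorem wordPhi_nonneg (n : ℕ) (i : ZMod n) (w : List (ZMod n)) : 0 ≤ wordPhi n i w := by
  induction w with
  | nil => simp [wordPhi]
  | cons a w ih => simp only [wordPhi]; omega

theorem wordF_eq_none_iff (n : ℕ) (i : ZMod n) (w : List (ZMod n)) :
    wordF n i w = none ↔ wordPhi n i w = 0 := by
  induction w with
  | nil => simp [wordF, wordPhi]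
  | cons a w ih =>
    have h0 := wordEps_nonneg n i w
    have h1 := wordPhi_eq n i w
    have h2 := wordPhi_nonneg n i w
    simp only [wordF, wordPhi, letterPhi, letterF] at *
    by_cases ha : a = i
    · subst ha
      by_cases hb : wordEps n a w = 0
      · simp [hb]; omega
      · have : ¬ (wordEps n a w < 1) := by omega
        simp [this, ih]; omega
    · have : ¬ (wordEps n i w < 0) := by omega
      simp [ha, this, ih]; omega

section
variable {n : ℕ} [Fact (1 < n)]

theorem wordEps_cons (i a : ZMod n) (w : List (ZMod n)) :
    wordEps n i (a :: w) = if a = i then max 0 (wordEps n i w - 1)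
      else if a = i + 1 then wordEps n i w + 1 else wordEps n i w := by
  have h := letterPhi_sub_letterEps n i a
  have h0 := wordEps_nonneg n i w
  have h1 : i ≠ i + 1 := by simp
  simp only [wordEps, ← h, letterPhi, letterEps]
  split_ifs <;> first | omega | (exfalso; simp_all)

theorem wordE_eq_none_iff (i : ZMod n) (w : List (ZMod n)) :
    wordE n i w = none ↔ wordEps n i w = 0 := by
  induction w with
  | nil => simp [wordE, wordEps]
  | cons a w ih =>
    have h0 := wordEps_nonneg n i w
    have h1 : i ≠ i + 1 := by simp
    rw [wordEps_cons]
    simp only [wordE, letterPhi, letterE]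
    split_ifs <;> simp_all <;> omega

/-- The tensor product rule for `e_i (a ⊗ w)`. -/
theorem wordE_cons_eq_some (i a : ZMod n) (w y : List (ZMod n)) :
    wordE n i (a :: w) = some y ↔
      (a = i + 1 ∧ wordEps n i w = 0 ∧ y = i :: w) ∨
      (∃ w', wordE n i w = some w' ∧ y = a :: w' ∧ (a = i → 2 ≤ wordEps n i w)) := by
  have h0 := wordEps_nonneg n i w
  have h1 : i ≠ i + 1 := by simp
  have h2 := wordE_eq_none_iff i w
  have h3 : ∀ w', wordE n i w = some w' → 0 < wordEps n i w := by
    intro w' hw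
    rcases h0.lt_or_eq with h | h
    · exact h
    · rw [h2.2 h.symm] at hw; simp at hw
  by_cases ha : a = i
  · subst ha
    by_cases hb : wordEps n a w ≤ 1
    · simp only [wordE, letterPhi, letterE, if_true, hb, h1, if_false]
      simp only [Option.map_none, false_and, false_or, reduceCtorEq, false_iff]
      rintro ⟨w', -, -, h⟩
      have := h trivial
      omega
    · simp only [wordE, letterPhi, if_true, hb, h1, if_false, Option.map_eq_some_iff]
      simp only [false_and, false_or, forall_true_left]
      exact exists_congr fun w' => and_congr_right fun _ =>
        ⟨fun h => ⟨h.symm, by omega⟩, fun h => h.1.symm⟩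
  · by_cases hb : wordEps n i w = 0
    · simp only [wordE, letterPhi, letterE, ha, if_false, hb, le_refl, if_true, h2.2 hb]
      by_cases hc : a = i + 1 <;> simp [hc, eq_comm]
    · have hb' : ¬ wordEps n i w ≤ 0 := by omega
      simp only [wordE, letterPhi, ha, if_false, hb', hb, Option.map_eq_some_iff, false_and,
        and_false, false_or, IsEmpty.forall_iff, and_true, eq_comm (a := y)]

theorem wordEps_wordE (i : ZMod n) (w y : List (ZMod n)) (h : wordE n i w = some y) :
    wordEps n i w = wordEps n i y + 1 := by
  induction w generalizing y with
  | nil => simp [wordE] at h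
  | cons a w ih =>
    have h1 : i ≠ i + 1 := by simp
    rw [wordE_cons_eq_some] at h
    rcases h with ⟨rfl, h, rfl⟩ | ⟨w', hw, rfl, h⟩
    · simp [wordEps_cons, h]
    · have := ih _ hw
      rw [wordEps_cons, wordEps_cons]
      split_ifs with ha hb
      · have := h ha; omega
      · omega
      · omega

theorem wordE_length (i : ZMod n) (w y : List (ZMod n)) (h : wordE n i w = some y) :
    y.length = w.length := by
  induction w generalizing y with
  | nil => simp [wordE] at h
  | cons a w ih =>
    rw [wordE_cons_eq_some] at h
    rcases h with ⟨rfl, h, rfl⟩ | ⟨w', hw, rfl, h⟩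
    · simp
    · simp [ih _ hw]

end

/-! ### Rank two relations on words -/

/-- The part of the local axioms of an `A₂`-crystal at `x` that singles out the first color.
Applying `e₁` changes `ε₂` by `0` or `1`; along an `e₁`-string the changes are first `0` and then
`1`; and if `e₁` raises `ε₂`, a subsequent `e₂` does not raise `ε₁`. -/
structure IsHalfLocalA2At {B : Type*} (e₁ e₂ : B → Option B) (ε₁ ε₂ : B → ℤ) (x : B) :
    Prop where
  eps_le : ∀ z, e₁ x = some z → ε₂ z = ε₂ x ∨ ε₂ z = ε₂ x + 1
  convex : ∀ y z, e₁ x = some y → e₁ y = some z → ε₂ y = ε₂ x + 1 → ε₂ z = ε₂ y + 1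
  turn : ∀ y z, e₁ x = some y → e₂ y = some z → ε₂ y = ε₂ x + 1 → ε₁ z = ε₁ y

/-- The local axioms of an `A₂`-crystal at `x`, in terms of the raising operators only. Where both
`e₁` and `e₂` apply to `x`, they commute unless `e₁` raises `ε₂` and `e₂` raises `ε₁`; in that case
`e₁ e₂² e₁ x = e₂ e₁² e₂ x`. The axioms `convex` and `turn` are stronger than Stembridge's at a
single vertex. They make the list stable under tensoring with a letter, and they imply the
corresponding facts about lowering operators. -/
structure IsLocalA2At {B : Type*} (e₁ e₂ : B → Option B) (ε₁ ε₂ : B → ℤ) (x : B) : Prop where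
  left : IsHalfLocalA2At e₁ e₂ ε₁ ε₂ x
  right : IsHalfLocalA2At e₂ e₁ ε₂ ε₁ x
  not_both : ∀ z v, e₁ x = some z → e₂ x = some v → ε₂ z = ε₂ x + 1 ∨ ε₁ v = ε₁ x + 1
  square : ∀ z v, e₁ x = some z → e₂ x = some v → ε₂ z = ε₂ x ∨ ε₁ v = ε₁ x →
    ∃ y, e₂ z = some y ∧ e₁ v = some y
  octagon : ∀ z v, e₁ x = some z → e₂ x = some v → ε₂ z = ε₂ x + 1 → ε₁ v = ε₁ x + 1 →
    ∃ z₁ z₂ v₁ v₂ y, (e₂ z = some z₁ ∧ e₂ z₁ = some z₂ ∧ e₁ z₂ = some y ∧ ε₁ z₂ = ε₁ x) ∧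
      (e₁ v = some v₁ ∧ e₁ v₁ = some v₂ ∧ e₂ v₂ = some y ∧ ε₂ v₂ = ε₂ x)

theorem IsLocalA2At.symm {B : Type*} {e₁ e₂ : B → Option B} {ε₁ ε₂ : B → ℤ} {x : B}
    (h : IsLocalA2At e₁ e₂ ε₁ ε₂ x) : IsLocalA2At e₂ e₁ ε₂ ε₁ x where
  left := h.right
  right := h.left
  not_both z v hz hv := (h.not_both v z hv hz).symm
  square z v hz hv hc := (h.square v z hv hz hc.symm).imp fun _ => And.symm
  octagon z v hz hv hz' hv' := by
    obtain ⟨z₁, z₂, v₁, v₂, y, h₁, h₂⟩ := h.octagon v z hv hz hv' hz'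
    exact ⟨v₁, v₂, z₁, z₂, y, h₂, h₁⟩

section
variable {n : ℕ} [Fact (1 < n)]

theorem wordEps_cons_self (i : ZMod n) (w : List (ZMod n)) :
    wordEps n i (i :: w) = max 0 (wordEps n i w - 1) := by simp [wordEps_cons]

theorem wordEps_cons_succ (i : ZMod n) (w : List (ZMod n)) :
    wordEps n i ((i + 1) :: w) = wordEps n i w + 1 := by simp [wordEps_cons]

theorem wordEps_cons_of_ne {i a : ZMod n} (h : a ≠ i) (h' : a ≠ i + 1) (w : List (ZMod n)) :
    wordEps n i (a :: w) = wordEps n i w := by simp [wordEps_cons, h, h']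

theorem wordE_cons_self (i : ZMod n) (w y : List (ZMod n)) :
    wordE n i (i :: w) = some y ↔
      ∃ w', wordE n i w = some w' ∧ y = i :: w' ∧ 2 ≤ wordEps n i w := by
  simp [wordE_cons_eq_some]

theorem wordE_cons_succ (i : ZMod n) (w y : List (ZMod n)) :
    wordE n i ((i + 1) :: w) = some y ↔ (wordEps n i w = 0 ∧ y = i :: w) ∨
      ∃ w', wordE n i w = some w' ∧ y = (i + 1) :: w' := by
  simp [wordE_cons_eq_some]

theorem wordE_cons_of_ne {i a : ZMod n} (h : a ≠ i) (h' : a ≠ i + 1) (w y : List (ZMod n)) :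
    wordE n i (a :: w) = some y ↔ ∃ w', wordE n i w = some w' ∧ y = a :: w' := by
  simp [wordE_cons_eq_some, h, h']

theorem exists_wordE {i : ZMod n} {w : List (ZMod n)} (h : 0 < wordEps n i w) :
    ∃ y, wordE n i w = some y := by
  rw [← Option.ne_none_iff_exists', Ne, wordE_eq_none_iff]
  omega

/-- The letter `i` in front of a word, to which neither `e_i` nor `e_{i+1}` applies. -/
theorem isLocalA2At_cons_self (i : ZMod n) (hi : i + 1 + 1 ≠ i) (w : List (ZMod n))
    (ih : IsLocalA2At (wordE n i) (wordE n (i + 1)) (wordEps n i) (wordEps n (i + 1)) w) :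
    IsLocalA2At (wordE n i) (wordE n (i + 1)) (wordEps n i) (wordEps n (i + 1)) (i :: w) := by
  obtain ⟨⟨A1, A2, A3⟩, ⟨B1, B2, B3⟩, C1, C2, C3⟩ := ih
  have n0 := wordEps_nonneg n i
  have n1 := wordEps_nonneg n (i + 1)
  have s0 := wordEps_wordE i
  have s1 := wordEps_wordE (i + 1)
  have h1 : i ≠ i + 1 := by simp
  have e0 := wordE_cons_self i
  have ε0 := wordEps_cons_self i
  have e1 := wordE_cons_of_ne h1 hi.symm
  have ε1 := wordEps_cons_of_ne h1 hi.symm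
  refine ⟨⟨?_, ?_, ?_⟩, ⟨?_, ?_, ?_⟩, ?_, ?_, ?_⟩
  · intro z Hz
    obtain ⟨z, hz, rfl, h⟩ := (e0 _ _).1 Hz
    rw [ε1, ε1]
    exact A1 _ hz
  · intro y z Hy Hz
    obtain ⟨y, hy, rfl, h⟩ := (e0 _ _).1 Hy
    obtain ⟨z, hz, rfl, h'⟩ := (e0 _ _).1 Hz
    rw [ε1, ε1, ε1]
    exact A2 _ _ hy hz
  · intro y z Hy Hz
    obtain ⟨y, hy, rfl, h⟩ := (e0 _ _).1 Hy
    obtain ⟨z, hz, rfl⟩ := (e1 _ _).1 Hz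
    rw [ε1, ε1, ε0, ε0]
    intro h
    rw [A3 _ _ hy hz h]
  · intro z Hz
    obtain ⟨z, hz, rfl⟩ := (e1 _ _).1 Hz
    rw [ε0, ε0]
    have := B1 _ hz
    omega
  · intro y z Hy Hz
    obtain ⟨y, hy, rfl⟩ := (e1 _ _).1 Hy
    obtain ⟨z, hz, rfl⟩ := (e1 _ _).1 Hz
    rw [ε0, ε0, ε0]
    have := B1 _ hy
    have := B2 _ _ hy hz
    omega
  · intro y z Hy Hz
    obtain ⟨y, hy, rfl⟩ := (e1 _ _).1 Hy
    obtain ⟨z, hz, rfl, h⟩ := (e0 _ _).1 Hz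
    rw [ε0, ε0, ε1, ε1]
    have := B1 _ hy
    have := B3 _ _ hy hz
    omega
  · intro z v Hz Hv
    obtain ⟨z, hz, rfl, h⟩ := (e0 _ _).1 Hz
    obtain ⟨v, hv, rfl⟩ := (e1 _ _).1 Hv
    rw [ε0, ε0, ε1, ε1]
    have := C1 _ _ hz hv
    omega
  · intro z v Hz Hv
    obtain ⟨z, hz, rfl, h⟩ := (e0 _ _).1 Hz
    obtain ⟨v, hv, rfl⟩ := (e1 _ _).1 Hv
    rw [ε0, ε0, ε1, ε1]
    intro hc
    have := B1 _ hv
    obtain ⟨y, hy, hy'⟩ := C2 _ _ hz hv (by omega)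
    exact ⟨i :: y, (e1 _ _).2 ⟨y, hy, rfl⟩, (e0 _ _).2 ⟨y, hy', rfl, by omega⟩⟩
  · intro z v Hz Hv
    obtain ⟨z, hz, rfl, h⟩ := (e0 _ _).1 Hz
    obtain ⟨v, hv, rfl⟩ := (e1 _ _).1 Hv
    rw [ε0, ε0, ε1, ε1]
    intro hc hc'
    obtain ⟨z₁, z₂, v₁, v₂, y, ⟨h1, h2, h3, h4⟩, h5, h6, h7, h8⟩ :=
      C3 _ _ hz hv (by omega) (by omega)
    have := s0 _ _ h5
    refine ⟨i :: z₁, i :: z₂, i :: v₁, i :: v₂, i :: y, ⟨(e1 _ _).2 ⟨_, h1, rfl⟩,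
      (e1 _ _).2 ⟨_, h2, rfl⟩, (e0 _ _).2 ⟨_, h3, rfl, by omega⟩, by rw [ε0, h4]⟩,
      (e0 _ _).2 ⟨_, h5, rfl, by omega⟩, (e0 _ _).2 ⟨_, h6, rfl, by omega⟩,
      (e1 _ _).2 ⟨_, h7, rfl⟩, by rw [ε1, h8]⟩

/-- The letter `i + 1` in front of a word. The new relations occur when `e_i` acts on this letter
rather than on `w`. -/
theorem isLocalA2At_cons_succ (i : ZMod n) (hi : i + 1 + 1 ≠ i) (w : List (ZMod n))
    (ih : IsLocalA2At (wordE n i) (wordE n (i + 1)) (wordEps n i) (wordEps n (i + 1)) w)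
    (ih' : ∀ v, wordE n (i + 1) w = some v →
      IsLocalA2At (wordE n i) (wordE n (i + 1)) (wordEps n i) (wordEps n (i + 1)) v) :
    IsLocalA2At (wordE n i) (wordE n (i + 1)) (wordEps n i) (wordEps n (i + 1))
      ((i + 1) :: w) := by
  obtain ⟨⟨A1, A2, A3⟩, ⟨B1, B2, B3⟩, C1, C2, C3⟩ := ih
  have n0 := wordEps_nonneg n i
  have n1 := wordEps_nonneg n (i + 1)
  have s0 := wordEps_wordE i
  have s1 := wordEps_wordE (i + 1)
  have h1 : i ≠ i + 1 := by simp
  have e0 := wordE_cons_succ i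
  have ε0 := wordEps_cons_succ i
  have e1 := wordE_cons_self (i + 1)
  have ε1 := wordEps_cons_self (i + 1)
  have e0' := wordE_cons_self i
  have ε0' := wordEps_cons_self i
  have e1' := wordE_cons_of_ne h1 hi.symm
  have ε1' := wordEps_cons_of_ne h1 hi.symm
  refine ⟨⟨?_, ?_, ?_⟩, ⟨?_, ?_, ?_⟩, ?_, ?_, ?_⟩
  · intro z Hz
    obtain ⟨h, rfl⟩ | ⟨z, hz, rfl⟩ := (e0 _ _).1 Hz
    · rw [ε1, ε1']
      have := n1 w
      omega
    · rw [ε1, ε1]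
      have := A1 _ hz
      omega
  · intro y z Hy Hz
    obtain ⟨h, rfl⟩ | ⟨y, hy, rfl⟩ := (e0 _ _).1 Hy
    · obtain ⟨z, hz, rfl, h'⟩ := (e0' _ _).1 Hz
      omega
    have := A1 _ hy
    obtain ⟨h, rfl⟩ | ⟨z, hz, rfl⟩ := (e0 _ _).1 Hz
    · rw [ε1, ε1, ε1']
      have := n1 w
      omega
    · rw [ε1, ε1, ε1]
      have := A2 _ _ hy hz
      have := n1 w
      omega
  · intro y z Hy Hz
    obtain ⟨h, rfl⟩ | ⟨y, hy, rfl⟩ := (e0 _ _).1 Hy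
    · obtain ⟨z, hz, rfl⟩ := (e1' _ _).1 Hz
      rw [ε1', ε1, ε0', ε0']
      have := B1 _ hz
      omega
    · obtain ⟨z, hz, rfl, h'⟩ := (e1 _ _).1 Hz
      have := A1 _ hy
      have := A3 _ _ hy hz
      rw [ε1, ε1, ε0, ε0]
      omega
  · intro z Hz
    obtain ⟨z, hz, rfl, h⟩ := (e1 _ _).1 Hz
    rw [ε0, ε0]
    have := B1 _ hz
    omega
  · intro y z Hy Hz
    obtain ⟨y, hy, rfl, h⟩ := (e1 _ _).1 Hy
    obtain ⟨z, hz, rfl, h'⟩ := (e1 _ _).1 Hz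
    rw [ε0, ε0, ε0]
    have := B2 _ _ hy hz
    omega
  · intro y z Hy Hz
    obtain ⟨y, hy, rfl, h⟩ := (e1 _ _).1 Hy
    have := n0 w
    rw [ε0, ε0]
    intro hr
    obtain ⟨h, rfl⟩ | ⟨z, hz, rfl⟩ := (e0 _ _).1 Hz
    · omega
    rw [ε1, ε1, B3 _ _ hy hz (by omega)]
  · intro z v Hz Hv
    obtain ⟨v, hv, rfl, h⟩ := (e1 _ _).1 Hv
    obtain ⟨h, rfl⟩ | ⟨z, hz, rfl⟩ := (e0 _ _).1 Hz
    · rw [ε1, ε1']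
      omega
    · have := C1 _ _ hz hv
      rw [ε0, ε0, ε1, ε1]
      omega
  · intro z v Hz Hv
    obtain ⟨v, hv, rfl, h⟩ := (e1 _ _).1 Hv
    obtain ⟨h, rfl⟩ | ⟨z, hz, rfl⟩ := (e0 _ _).1 Hz
    · rw [ε0, ε0, ε1, ε1']
      intro hc
      exact ⟨i :: v, (e1' _ _).2 ⟨v, hv, rfl⟩, (e0 _ _).2 (Or.inl ⟨by omega, rfl⟩)⟩
    · rw [ε0, ε0, ε1, ε1]
      intro hc
      have := A1 _ hz
      obtain ⟨y, hy, hy'⟩ := C2 _ _ hz hv (by omega)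
      exact ⟨(i + 1) :: y, (e1 _ _).2 ⟨y, hy, rfl, by omega⟩, (e0 _ _).2 (Or.inr ⟨y, hy', rfl⟩)⟩
  · intro z v Hz Hv
    obtain ⟨v, hv, rfl, h⟩ := (e1 _ _).1 Hv
    obtain ⟨h0, rfl⟩ | ⟨z, hz, rfl⟩ := (e0 _ _).1 Hz
    · rw [ε0, ε0, ε1, ε1']
      intro hc hc'
      -- `e_i` acts on the letter in front at `x`, and on `w` once `e_{i+1}` has been applied
      have s1v := s1 _ _ hv
      obtain ⟨z₂, hz₂⟩ := exists_wordE (i := i + 1) (w := v) (by omega)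
      obtain ⟨v₁, hv₁⟩ := exists_wordE (i := i) (w := v) (by omega)
      have hv' := ih' v hv
      have h3 := B2 _ _ hv hz₂ (by omega)
      have h4 := B3 _ _ hv hv₁ (by omega)
      have h5 := s0 _ _ hv₁
      obtain ⟨y, hy, hy'⟩ := hv'.square _ _ hv₁ hz₂ (Or.inl h4)
      exact ⟨i :: v, i :: z₂, (i + 1) :: v₁, i :: v₁, i :: y,
        ⟨(e1' _ _).2 ⟨_, hv, rfl⟩, (e1' _ _).2 ⟨_, hz₂, rfl⟩,
          (e0' _ _).2 ⟨_, hy', rfl, by omega⟩, by rw [ε0']; omega⟩,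
        (e0 _ _).2 (Or.inr ⟨_, hv₁, rfl⟩), (e0 _ _).2 (Or.inl ⟨by omega, rfl⟩),
          (e1' _ _).2 ⟨_, hy, rfl⟩, by rw [ε1']; omega⟩
    · rw [ε0, ε0, ε1, ε1]
      intro hc hc'
      obtain ⟨z₁, z₂, v₁, v₂, y, ⟨h1, h2, h3, h4⟩, h5, h6, h7, h8⟩ :=
        C3 _ _ hz hv (by omega) (by omega)
      have := s1 _ _ h1
      have := s1 _ _ h2
      exact ⟨(i + 1) :: z₁, (i + 1) :: z₂, (i + 1) :: v₁, (i + 1) :: v₂, (i + 1) :: y,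
        ⟨(e1 _ _).2 ⟨_, h1, rfl, by omega⟩, (e1 _ _).2 ⟨_, h2, rfl, by omega⟩,
          (e0 _ _).2 (Or.inr ⟨_, h3, rfl⟩), by rw [ε0, h4]⟩,
        (e0 _ _).2 (Or.inr ⟨_, h5, rfl⟩), (e0 _ _).2 (Or.inr ⟨_, h6, rfl⟩),
          (e1 _ _).2 ⟨_, h7, rfl, by omega⟩, by rw [ε1, h8]⟩

/-- The letter `i + 2` in front of a word. The new relations occur when `e_{i+1}` acts on this
letter rather than on `w`. -/
theorem isLocalA2At_cons_succ_succ (i : ZMod n) (hi : i + 1 + 1 ≠ i) (w : List (ZMod n))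
    (ih : IsLocalA2At (wordE n i) (wordE n (i + 1)) (wordEps n i) (wordEps n (i + 1)) w)
    (ih' : ∀ v, wordE n i w = some v →
      IsLocalA2At (wordE n i) (wordE n (i + 1)) (wordEps n i) (wordEps n (i + 1)) v) :
    IsLocalA2At (wordE n i) (wordE n (i + 1)) (wordEps n i) (wordEps n (i + 1))
      ((i + 1 + 1) :: w) := by
  obtain ⟨⟨A1, A2, A3⟩, ⟨B1, B2, B3⟩, C1, C2, C3⟩ := ih
  have n0 := wordEps_nonneg n i
  have n1 := wordEps_nonneg n (i + 1)
  have s0 := wordEps_wordE i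
  have s1 := wordEps_wordE (i + 1)
  have h2 : i + 1 + 1 ≠ i + 1 := by simp
  have e0 := wordE_cons_of_ne hi h2
  have ε0 := wordEps_cons_of_ne hi h2
  have e1 := wordE_cons_succ (i + 1)
  have ε1 := wordEps_cons_succ (i + 1)
  have e0' := wordE_cons_succ i
  have ε0' := wordEps_cons_succ i
  have e1' := wordE_cons_self (i + 1)
  have ε1' := wordEps_cons_self (i + 1)
  refine ⟨⟨?_, ?_, ?_⟩, ⟨?_, ?_, ?_⟩, ?_, ?_, ?_⟩
  · intro z Hz
    obtain ⟨z, hz, rfl⟩ := (e0 _ _).1 Hz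
    rw [ε1, ε1]
    have := A1 _ hz
    omega
  · intro y z Hy Hz
    obtain ⟨y, hy, rfl⟩ := (e0 _ _).1 Hy
    obtain ⟨z, hz, rfl⟩ := (e0 _ _).1 Hz
    rw [ε1, ε1, ε1]
    have := A2 _ _ hy hz
    omega
  · intro y z Hy Hz
    obtain ⟨y, hy, rfl⟩ := (e0 _ _).1 Hy
    have := n1 w
    rw [ε1, ε1]
    intro hr
    obtain ⟨h, rfl⟩ | ⟨z, hz, rfl⟩ := (e1 _ _).1 Hz
    · omega
    rw [ε0, ε0, A3 _ _ hy hz (by omega)]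
  · intro z Hz
    obtain ⟨h, rfl⟩ | ⟨z, hz, rfl⟩ := (e1 _ _).1 Hz
    · rw [ε0, ε0']
      omega
    · rw [ε0, ε0]
      exact B1 _ hz
  · intro y z Hy Hz
    obtain ⟨h, rfl⟩ | ⟨y, hy, rfl⟩ := (e1 _ _).1 Hy
    · obtain ⟨z, hz, rfl, h'⟩ := (e1' _ _).1 Hz
      omega
    obtain ⟨h, rfl⟩ | ⟨z, hz, rfl⟩ := (e1 _ _).1 Hz
    · rw [ε0, ε0, ε0']
      omega
    · rw [ε0, ε0, ε0]
      exact B2 _ _ hy hz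
  · intro y z Hy Hz
    obtain ⟨h, rfl⟩ | ⟨y, hy, rfl⟩ := (e1 _ _).1 Hy
    · obtain ⟨h', rfl⟩ | ⟨z, hz, rfl⟩ := (e0' _ _).1 Hz
      · rw [ε1', wordEps_cons_of_ne (by simp) hi.symm]
        omega
      · rw [ε1', ε1']
        have := A1 _ hz
        omega
    · obtain ⟨z, hz, rfl⟩ := (e0 _ _).1 Hz
      rw [ε0, ε0, ε1, ε1]
      intro hr
      rw [B3 _ _ hy hz hr]
  · intro z v Hz Hv
    obtain ⟨z, hz, rfl⟩ := (e0 _ _).1 Hz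
    obtain ⟨h, rfl⟩ | ⟨v, hv, rfl⟩ := (e1 _ _).1 Hv
    · rw [ε0, ε0']
      omega
    · rw [ε0, ε0, ε1, ε1]
      have := C1 _ _ hz hv
      omega
  · intro z v Hz Hv
    obtain ⟨z, hz, rfl⟩ := (e0 _ _).1 Hz
    obtain ⟨h, rfl⟩ | ⟨v, hv, rfl⟩ := (e1 _ _).1 Hv
    · rw [ε0, ε0', ε1, ε1]
      intro hc
      exact ⟨(i + 1) :: z, (e1 _ _).2 (Or.inl ⟨by omega, rfl⟩), (e0' _ _).2 (Or.inr ⟨z, hz, rfl⟩)⟩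
    · rw [ε0, ε0, ε1, ε1]
      intro hc
      obtain ⟨y, hy, hy'⟩ := C2 _ _ hz hv (by omega)
      exact ⟨(i + 1 + 1) :: y, (e1 _ _).2 (Or.inr ⟨y, hy, rfl⟩), (e0 _ _).2 ⟨y, hy', rfl⟩⟩
  · intro z v Hz Hv
    obtain ⟨z, hz, rfl⟩ := (e0 _ _).1 Hz
    obtain ⟨h0, rfl⟩ | ⟨v, hv, rfl⟩ := (e1 _ _).1 Hv
    · rw [ε0, ε0', ε1, ε1]
      intro hc hc'
      -- `e_{i+1}` acts on the letter in front at `x`, and on `w` once `e_i` has been applied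
      have s0z := s0 _ _ hz
      obtain ⟨z₁, hz₁⟩ := exists_wordE (i := i + 1) (w := z) (by omega)
      have h3 := A3 _ _ hz hz₁ (by omega)
      have h4 := s1 _ _ hz₁
      have hz' := ih' z hz
      by_cases hE : wordEps n i z = 0
      · refine ⟨(i + 1 + 1) :: z₁, (i + 1) :: z₁, (i + 1) :: z, i :: z, i :: z₁,
          ⟨(e1 _ _).2 (Or.inr ⟨_, hz₁, rfl⟩), (e1 _ _).2 (Or.inl ⟨by omega, rfl⟩),
            (e0' _ _).2 (Or.inl ⟨by omega, rfl⟩), by rw [ε0']; omega⟩,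
          (e0' _ _).2 (Or.inr ⟨_, hz, rfl⟩), (e0' _ _).2 (Or.inl ⟨by omega, rfl⟩),
            (wordE_cons_of_ne (by simp) hi.symm _ _).2 ⟨_, hz₁, rfl⟩, ?_⟩
        rw [wordEps_cons_of_ne (by simp) hi.symm]
        omega
      · have := n0 z
        obtain ⟨v₂, hv₂⟩ := exists_wordE (i := i) (w := z) (by omega)
        obtain ⟨y, hy, hy'⟩ := hz'.square _ _ hv₂ hz₁ (Or.inr h3)
        have h5 := A2 _ _ hz hv₂ (by omega)
        exact ⟨(i + 1 + 1) :: z₁, (i + 1) :: z₁, (i + 1) :: z, (i + 1) :: v₂, (i + 1) :: y,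
          ⟨(e1 _ _).2 (Or.inr ⟨_, hz₁, rfl⟩), (e1 _ _).2 (Or.inl ⟨by omega, rfl⟩),
            (e0' _ _).2 (Or.inr ⟨_, hy', rfl⟩), by rw [ε0']; omega⟩,
          (e0' _ _).2 (Or.inr ⟨_, hz, rfl⟩), (e0' _ _).2 (Or.inr ⟨_, hv₂, rfl⟩),
            (e1' _ _).2 ⟨_, hy, rfl, by omega⟩, by rw [ε1']; omega⟩
    · rw [ε0, ε0, ε1, ε1]
      intro hc hc'
      obtain ⟨z₁, z₂, v₁, v₂, y, ⟨h1, h2, h3, h4⟩, h5, h6, h7, h8⟩ :=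
        C3 _ _ hz hv (by omega) (by omega)
      exact ⟨(i + 1 + 1) :: z₁, (i + 1 + 1) :: z₂, (i + 1 + 1) :: v₁, (i + 1 + 1) :: v₂,
        (i + 1 + 1) :: y, ⟨(e1 _ _).2 (Or.inr ⟨_, h1, rfl⟩), (e1 _ _).2 (Or.inr ⟨_, h2, rfl⟩),
          (e0 _ _).2 ⟨_, h3, rfl⟩, by rw [ε0, h4]⟩,
        (e0 _ _).2 ⟨_, h5, rfl⟩, (e0 _ _).2 ⟨_, h6, rfl⟩,
          (e1 _ _).2 (Or.inr ⟨_, h7, rfl⟩), by rw [ε1, h8]⟩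

theorem isLocalA2At_cons_of_ne (i : ZMod n) {a : ZMod n} (h0 : a ≠ i) (h1 : a ≠ i + 1)
    (h2 : a ≠ i + 1 + 1) (w : List (ZMod n))
    (ih : IsLocalA2At (wordE n i) (wordE n (i + 1)) (wordEps n i) (wordEps n (i + 1)) w) :
    IsLocalA2At (wordE n i) (wordE n (i + 1)) (wordEps n i) (wordEps n (i + 1)) (a :: w) := by
  obtain ⟨⟨A1, A2, A3⟩, ⟨B1, B2, B3⟩, C1, C2, C3⟩ := ih
  have e0 := wordE_cons_of_ne h0 h1
  have ε0 := wordEps_cons_of_ne h0 h1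
  have e1 := wordE_cons_of_ne h1 h2
  have ε1 := wordEps_cons_of_ne h1 h2
  refine ⟨⟨?_, ?_, ?_⟩, ⟨?_, ?_, ?_⟩, ?_, ?_, ?_⟩
  · intro z Hz
    obtain ⟨z, hz, rfl⟩ := (e0 _ _).1 Hz
    rw [ε1, ε1]
    exact A1 _ hz
  · intro y z Hy Hz
    obtain ⟨y, hy, rfl⟩ := (e0 _ _).1 Hy
    obtain ⟨z, hz, rfl⟩ := (e0 _ _).1 Hz
    rw [ε1, ε1, ε1]
    exact A2 _ _ hy hz
  · intro y z Hy Hz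
    obtain ⟨y, hy, rfl⟩ := (e0 _ _).1 Hy
    obtain ⟨z, hz, rfl⟩ := (e1 _ _).1 Hz
    rw [ε0, ε0, ε1, ε1]
    exact A3 _ _ hy hz
  · intro z Hz
    obtain ⟨z, hz, rfl⟩ := (e1 _ _).1 Hz
    rw [ε0, ε0]
    exact B1 _ hz
  · intro y z Hy Hz
    obtain ⟨y, hy, rfl⟩ := (e1 _ _).1 Hy
    obtain ⟨z, hz, rfl⟩ := (e1 _ _).1 Hz
    rw [ε0, ε0, ε0]
    exact B2 _ _ hy hz
  · intro y z Hy Hz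
    obtain ⟨y, hy, rfl⟩ := (e1 _ _).1 Hy
    obtain ⟨z, hz, rfl⟩ := (e0 _ _).1 Hz
    rw [ε0, ε0, ε1, ε1]
    exact B3 _ _ hy hz
  · intro z v Hz Hv
    obtain ⟨z, hz, rfl⟩ := (e0 _ _).1 Hz
    obtain ⟨v, hv, rfl⟩ := (e1 _ _).1 Hv
    rw [ε0, ε0, ε1, ε1]
    exact C1 _ _ hz hv
  · intro z v Hz Hv
    obtain ⟨z, hz, rfl⟩ := (e0 _ _).1 Hz
    obtain ⟨v, hv, rfl⟩ := (e1 _ _).1 Hv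
    rw [ε0, ε0, ε1, ε1]
    intro hc
    obtain ⟨y, hy, hy'⟩ := C2 _ _ hz hv hc
    exact ⟨a :: y, (e1 _ _).2 ⟨y, hy, rfl⟩, (e0 _ _).2 ⟨y, hy', rfl⟩⟩
  · intro z v Hz Hv
    obtain ⟨z, hz, rfl⟩ := (e0 _ _).1 Hz
    obtain ⟨v, hv, rfl⟩ := (e1 _ _).1 Hv
    rw [ε0, ε0, ε1, ε1]
    intro hc hc'
    obtain ⟨z₁, z₂, v₁, v₂, y, ⟨h1, h2, h3, h4⟩, h5, h6, h7, h8⟩ := C3 _ _ hz hv hc hc'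
    exact ⟨a :: z₁, a :: z₂, a :: v₁, a :: v₂, a :: y,
      ⟨(e1 _ _).2 ⟨_, h1, rfl⟩, (e1 _ _).2 ⟨_, h2, rfl⟩, (e0 _ _).2 ⟨_, h3, rfl⟩,
        by rw [ε0, h4]⟩,
      (e0 _ _).2 ⟨_, h5, rfl⟩, (e0 _ _).2 ⟨_, h6, rfl⟩, (e1 _ _).2 ⟨_, h7, rfl⟩,
        by rw [ε1, h8]⟩

/-- Words satisfy the local `A₂` axioms for the colors `i` and `i + 1`. The induction is on the
length because the axioms at `a :: w` also use those at `e_i w` and `e_{i+1} w`. -/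
theorem isLocalA2At_word (i : ZMod n) (hi : i + 1 + 1 ≠ i) (m : ℕ) :
    ∀ w : List (ZMod n), w.length = m →
      IsLocalA2At (wordE n i) (wordE n (i + 1)) (wordEps n i) (wordEps n (i + 1)) w := by
  induction m with
  | zero =>
    intro w hw
    obtain rfl := List.length_eq_zero_iff.1 hw
    constructor <;> first | (constructor <;> simp [wordE]) | simp [wordE]
  | succ m ih =>
    rintro (_ | ⟨a, w⟩) hw
    · simp at hw
    have hl : w.length = m := by simpa using hw
    by_cases h0 : a = i
    · subst h0
      exact isLocalA2At_cons_self a hi w (ih w hl)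
    by_cases h1 : a = i + 1
    · subst h1
      exact isLocalA2At_cons_succ i hi w (ih w hl)
        fun v hv => ih v ((wordE_length _ _ _ hv).trans hl)
    by_cases h2 : a = i + 1 + 1
    · subst h2
      exact isLocalA2At_cons_succ_succ i hi w (ih w hl)
        fun v hv => ih v ((wordE_length _ _ _ hv).trans hl)
    exact isLocalA2At_cons_of_ne i h0 h1 h2 w (ih w hl)

theorem wordEps_wordE_of_not_adj {i j : ZMod n} (hij : i ≠ j) (h1 : j ≠ i + 1) (h2 : i ≠ j + 1)
    {w z : List (ZMod n)} (hz : wordE n i w = some z) : wordEps n j z = wordEps n j w := by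
  have hs : i + 1 ≠ j + 1 := fun h => hij (add_right_cancel h)
  induction w generalizing z with
  | nil => simp [wordE] at hz
  | cons a w ih =>
    rcases (wordE_cons_eq_some _ _ _ _).1 hz with ⟨rfl, -, rfl⟩ | ⟨z', hz', rfl, -⟩
    · rw [wordEps_cons_of_ne hij h2, wordEps_cons_of_ne h1.symm hs]
    · rw [wordEps_cons, wordEps_cons, ih hz']

/-- Operators of colors that are not neighbours in the Dynkin diagram commute on words. -/
theorem wordE_comm_of_not_adj {i j : ZMod n} (hij : i ≠ j) (h1 : j ≠ i + 1) (h2 : i ≠ j + 1)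
    {w z v : List (ZMod n)} (hz : wordE n i w = some z) (hv : wordE n j w = some v) :
    ∃ y, wordE n j z = some y ∧ wordE n i v = some y := by
  have hs : i + 1 ≠ j + 1 := fun h => hij (add_right_cancel h)
  induction w generalizing z v with
  | nil => simp [wordE] at hz
  | cons a w ih =>
    rcases (wordE_cons_eq_some _ _ _ _).1 hz with ⟨rfl, h, rfl⟩ | ⟨z', hz', rfl, h⟩
    · obtain ⟨v', hv', rfl⟩ := (wordE_cons_of_ne h1.symm hs _ _).1 hv
      have := wordEps_wordE_of_not_adj hij.symm h2 h1 hv'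
      exact ⟨i :: v', (wordE_cons_of_ne hij h2 _ _).2 ⟨v', hv', rfl⟩,
        (wordE_cons_succ _ _ _).2 (Or.inl ⟨by omega, rfl⟩)⟩
    · have hz1 := wordEps_wordE_of_not_adj hij h1 h2 hz'
      rcases (wordE_cons_eq_some _ _ _ _).1 hv with ⟨rfl, h', rfl⟩ | ⟨v', hv', rfl, h'⟩
      · exact ⟨j :: z', (wordE_cons_succ _ _ _).2 (Or.inl ⟨by omega, rfl⟩),
          (wordE_cons_of_ne hij.symm h1 _ _).2 ⟨z', hz', rfl⟩⟩
      · have hv1 := wordEps_wordE_of_not_adj hij.symm h2 h1 hv'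
        obtain ⟨y, hy, hy'⟩ := ih hz' hv'
        refine ⟨a :: y, (wordE_cons_eq_some _ _ _ _).2 (Or.inr ⟨y, hy, rfl, ?_⟩),
          (wordE_cons_eq_some _ _ _ _).2 (Or.inr ⟨y, hy', rfl, ?_⟩)⟩
        · rwa [hz1]
        · rwa [hv1]
end

/-! ### Stembridge crystals and their uniqueness -/

/-- A crystal for the colors in `I` with Cartan matrix `A`, in which `ε i` and `φ i` are the distances
to the two ends of the `i`-string. The weight enters only through its pairings `φ i - ε i` with the
coroots. -/
structure IsSeminormal {I B : Type*} (A : I → I → ℤ) (e f : I → B → Option B)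
    (ε φ : I → B → ℤ) : Prop where
  f_iff_e : ∀ i x y, f i x = some y ↔ e i y = some x
  eps_nonneg : ∀ i x, 0 ≤ ε i x
  phi_nonneg : ∀ i x, 0 ≤ φ i x
  e_eq_none : ∀ i x, e i x = none ↔ ε i x = 0
  f_eq_none : ∀ i x, f i x = none ↔ φ i x = 0
  eps_e : ∀ i x y, e i x = some y → ε i x = ε i y + 1
  wt_f : ∀ j x y, f j x = some y → ∀ i, φ i y - ε i y = φ i x - ε i x - A j i
  diag : ∀ i, A i i = 2

/-- A crystal of simply laced type with Stembridge's local axioms. Two raising operators that apply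
to `x` either commute or satisfy `e_i e_j² e_i x = e_j e_i² e_j x`, and which of the two relations
holds can be read off at the top `y` of the relation from the values of `φ`; conversely, these
values at `y` force the relation among the lowering operators below `y`. -/
structure IsStembridge {I B : Type*} (A : I → I → ℤ) (e f : I → B → Option B)
    (ε φ : I → B → ℤ) : Prop extends IsSeminormal A e f ε φ where
  up : ∀ i j, i ≠ j → ∀ x z v, e i x = some z → e j x = some v →
    (∃ y, e j z = some y ∧ e i v = some y ∧ (A i j = 0 ∨ φ i z = φ i y ∨ φ j v = φ j y)) ∨
    (A i j ≠ 0 ∧ ∃ z₁ z₂ v₁ v₂ y,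
      (e j z = some z₁ ∧ e j z₁ = some z₂ ∧ e i z₂ = some y ∧ φ j z₂ = φ j y + 1) ∧
      (e i v = some v₁ ∧ e i v₁ = some v₂ ∧ e j v₂ = some y ∧ φ i v₂ = φ i y + 1))
  down_square : ∀ i j, i ≠ j → ∀ y z v, f j y = some z → f i y = some v →
    (A i j = 0 ∨ φ i z = φ i y ∨ φ j v = φ j y) → ∃ x, f i z = some x ∧ f j v = some x
  down_octagon : ∀ i j, i ≠ j → A i j ≠ 0 → ∀ y z₂ v₂, f i y = some z₂ → f j y = some v₂ →
    φ j z₂ = φ j y + 1 → φ i v₂ = φ i y + 1 →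
    ∃ z₁ z v₁ v x, (f j z₂ = some z₁ ∧ f j z₁ = some z ∧ f i z = some x) ∧
      (f i v₂ = some v₁ ∧ f i v₁ = some v ∧ f j v = some x)

/-- `ParallelPath f f' x₀ y₀ d x y`: some sequence of `d` colors leads from `x₀` to `x` along `f` and
from `y₀` to `y` along `f'`. -/
inductive ParallelPath {I B C : Type*} (f : I → B → Option B) (f' : I → C → Option C)
    (x₀ : B) (y₀ : C) : ℕ → B → C → Prop
  | refl : ParallelPath f f' x₀ y₀ 0 x₀ y₀
  | step {d x y x' y'} (i : I) : ParallelPath f f' x₀ y₀ d x y → f i x = some x' →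
      f' i y = some y' → ParallelPath f f' x₀ y₀ (d + 1) x' y'

theorem ParallelPath.swap {I B C : Type*} {f : I → B → Option B} {f' : I → C → Option C}
    {x₀ : B} {y₀ : C} {d : ℕ} {x : B} {y : C} (h : ParallelPath f f' x₀ y₀ d x y) :
    ParallelPath f' f y₀ x₀ d y x := by
  induction h with
  | refl => exact .refl
  | step i _ hx hy ih => exact .step i ih hy hx

/-- All pairs at the ends of parallel paths of length `d` admit parallel steps back: a raising
operator that applies to the first element also applies to the second one, with results that are
again joined to the origin by parallel paths. -/
def Lifts {I B C : Type*} (e f : I → B → Option B) (e' f' : I → C → Option C)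
    (x₀ : B) (y₀ : C) (d : ℕ) : Prop :=
  ∀ x y, ParallelPath f f' x₀ y₀ d x y → ∀ i x', e i x = some x' →
    ∃ d' y', d = d' + 1 ∧ ParallelPath f f' x₀ y₀ d' x' y' ∧ e' i y = some y'

section
variable {I B C : Type*} {A : I → I → ℤ} {e f : I → B → Option B} {ε φ : I → B → ℤ}
  {e' f' : I → C → Option C} {ε' φ' : I → C → ℤ} {x₀ : B} {y₀ : C}

theorem eps_eq_of_lifts (hB : IsStembridge A e f ε φ) (hC : IsStembridge A e' f' ε' φ') {d : ℕ}
    (h₁ : ∀ m ≤ d, Lifts e f e' f' x₀ y₀ m) (h₂ : ∀ m ≤ d, Lifts e' f' e f y₀ x₀ m)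
    {x : B} {y : C} (h : ParallelPath f f' x₀ y₀ d x y) (i : I) : ε i x = ε' i y := by
  induction d using Nat.strong_induction_on generalizing x y with
  | _ d ih =>
    rcases hx : e i x with _ | x'
    · rcases hy : e' i y with _ | y'
      · rw [(hB.e_eq_none i x).1 hx, (hC.e_eq_none i y).1 hy]
      · obtain ⟨d', x', -, -, hx'⟩ := h₂ d le_rfl y x h.swap i y' hy
        simp [hx] at hx'
    · obtain ⟨d', y', rfl, h', hy⟩ := h₁ d le_rfl x y h i x' hx
      rw [hB.eps_e i x x' hx, hC.eps_e i y y' hy,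
        ih d' (by omega) (fun m hm => h₁ m (by omega)) (fun m hm => h₂ m (by omega)) h']

theorem wt_eq_of_parallelPath (hB : IsStembridge A e f ε φ) (hC : IsStembridge A e' f' ε' φ')
    (h₀ : ∀ i, φ i x₀ - ε i x₀ = φ' i y₀ - ε' i y₀) {d : ℕ} {x : B} {y : C}
    (h : ParallelPath f f' x₀ y₀ d x y) (i : I) : φ i x - ε i x = φ' i y - ε' i y := by
  induction h with
  | refl => exact h₀ i
  | step j _ hx hy ih => rw [hB.wt_f _ _ _ hx, hC.wt_f _ _ _ hy, ih]

theorem phi_eq_of_lifts (hB : IsStembridge A e f ε φ) (hC : IsStembridge A e' f' ε' φ')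
    (h₀ : ∀ i, φ i x₀ - ε i x₀ = φ' i y₀ - ε' i y₀) {d : ℕ}
    (h₁ : ∀ m ≤ d, Lifts e f e' f' x₀ y₀ m) (h₂ : ∀ m ≤ d, Lifts e' f' e f y₀ x₀ m)
    {x : B} {y : C} (h : ParallelPath f f' x₀ y₀ d x y) (i : I) : φ i x = φ' i y := by
  have := eps_eq_of_lifts hB hC h₁ h₂ h i
  have := wt_eq_of_parallelPath hB hC h₀ h i
  omega

theorem exists_f_of_lifts (hB : IsStembridge A e f ε φ) (hC : IsStembridge A e' f' ε' φ')
    (h₀ : ∀ i, φ i x₀ - ε i x₀ = φ' i y₀ - ε' i y₀) {d : ℕ}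
    (h₁ : ∀ m ≤ d, Lifts e f e' f' x₀ y₀ m) (h₂ : ∀ m ≤ d, Lifts e' f' e f y₀ x₀ m)
    {x x' : B} {y : C} (h : ParallelPath f f' x₀ y₀ d x y) {i : I} (hx : f i x = some x') :
    ∃ y', f' i y = some y' := by
  rw [← Option.ne_none_iff_exists', Ne, hC.f_eq_none, ← phi_eq_of_lifts hB hC h₀ h₁ h₂ h i,
    ← hB.f_eq_none, hx]
  simp

/-- The inductive step of the comparison of two crystals: a relation among raising operators in the
first crystal is determined by string lengths at its top, so that it also holds in the second one. -/
theorem lifts_succ (hB : IsStembridge A e f ε φ) (hC : IsStembridge A e' f' ε' φ')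
    (h₀ : ∀ i, φ i x₀ - ε i x₀ = φ' i y₀ - ε' i y₀) {d : ℕ}
    (h₁ : ∀ m ≤ d, Lifts e f e' f' x₀ y₀ m) (h₂ : ∀ m ≤ d, Lifts e' f' e f y₀ x₀ m) :
    Lifts e f e' f' x₀ y₀ (d + 1) := by
  intro x x' h j v hv
  obtain _ | @⟨_, z, z', _, _, i, h, hz, hz'⟩ := h
  have hxz := (hB.f_iff_e _ _ _).1 hz
  by_cases hij : i = j
  · subst hij
    obtain rfl : z = v := by simpa [hxz] using hv
    exact ⟨d, z', rfl, h, (hC.f_iff_e _ _ _).1 hz'⟩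
  rcases hB.up i j hij x z v hxz hv with ⟨y, hzy, hvy, hc⟩ |
    ⟨hA, z₁, z₂, v₁, v₂, y, ⟨hz₁, hz₂, hy, hcz⟩, hv₁, hv₂, hy', hcv⟩
  · obtain ⟨d, y', rfl, hyy, hzy'⟩ := h₁ d le_rfl z z' h j y hzy
    have H₁ : ∀ m ≤ d, Lifts e f e' f' x₀ y₀ m := fun m hm => h₁ m (by omega)
    have H₂ : ∀ m ≤ d, Lifts e' f' e f y₀ x₀ m := fun m hm => h₂ m (by omega)
    have hyv := (hB.f_iff_e _ _ _).2 hvy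
    obtain ⟨v', hyv'⟩ := exists_f_of_lifts hB hC h₀ H₁ H₂ hyy hyv
    have hvv := hyy.step i hyv hyv'
    rw [phi_eq_of_lifts hB hC h₀ h₁ h₂ h, phi_eq_of_lifts hB hC h₀ H₁ H₂ hyy,
      phi_eq_of_lifts hB hC h₀ h₁ h₂ hvv, phi_eq_of_lifts hB hC h₀ H₁ H₂ hyy] at hc
    obtain ⟨x'', hx, hx'⟩ :=
      hC.down_square i j hij y' z' v' ((hC.f_iff_e _ _ _).2 hzy') hyv' hc
    obtain rfl : x' = x'' := by simpa [hz'] using hx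
    exact ⟨d + 1, v', rfl, hvv, (hC.f_iff_e _ _ _).1 hx'⟩
  · obtain ⟨d, z₁', rfl, hd₁, hz₁'⟩ := h₁ d le_rfl z z' h j z₁ hz₁
    obtain ⟨d, z₂', rfl, hd₂, hz₂'⟩ := h₁ d (by omega) z₁ z₁' hd₁ j z₂ hz₂
    obtain ⟨d, y', rfl, hd, hyz'⟩ := h₁ d (by omega) z₂ z₂' hd₂ i y hy
    have H₁ : ∀ m ≤ d, Lifts e f e' f' x₀ y₀ m := fun m hm => h₁ m (by omega)
    have H₂ : ∀ m ≤ d, Lifts e' f' e f y₀ x₀ m := fun m hm => h₂ m (by omega)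
    have K₁ : ∀ m ≤ d + 1, Lifts e f e' f' x₀ y₀ m := fun m hm => h₁ m (by omega)
    have K₂ : ∀ m ≤ d + 1, Lifts e' f' e f y₀ x₀ m := fun m hm => h₂ m (by omega)
    have hyv := (hB.f_iff_e _ _ _).2 hy'
    obtain ⟨v₂', hyv'⟩ := exists_f_of_lifts hB hC h₀ H₁ H₂ hd hyv
    have hvv := hd.step j hyv hyv'
    rw [phi_eq_of_lifts hB hC h₀ K₁ K₂ hd₂, phi_eq_of_lifts hB hC h₀ H₁ H₂ hd] at hcz
    rw [phi_eq_of_lifts hB hC h₀ K₁ K₂ hvv, phi_eq_of_lifts hB hC h₀ H₁ H₂ hd] at hcv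
    obtain ⟨w₁, w, v₁', v', x'', ⟨e1, e2, e3⟩, e4, e5, e6⟩ :=
      hC.down_octagon i j hij hA y' z₂' v₂' ((hC.f_iff_e _ _ _).2 hyz') hyv' hcz hcv
    obtain rfl : z₁' = w₁ := by simpa [(hC.f_iff_e _ _ _).2 hz₂'] using e1
    obtain rfl : z' = w := by simpa [(hC.f_iff_e _ _ _).2 hz₁'] using e2
    obtain rfl : x' = x'' := by simpa [hz'] using e3
    exact ⟨d + 3, v', rfl, (hvv.step i ((hB.f_iff_e _ _ _).2 hv₂) e4).step i
      ((hB.f_iff_e _ _ _).2 hv₁) e5, (hC.f_iff_e _ _ _).1 e6⟩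

theorem lifts_all (hB : IsStembridge A e f ε φ) (hC : IsStembridge A e' f' ε' φ')
    (hx₀ : ∀ i, e i x₀ = none) (hy₀ : ∀ i, e' i y₀ = none)
    (h₀ : ∀ i, φ i x₀ - ε i x₀ = φ' i y₀ - ε' i y₀) (d : ℕ) :
    Lifts e f e' f' x₀ y₀ d ∧ Lifts e' f' e f y₀ x₀ d := by
  induction d using Nat.strong_induction_on with
  | _ d ih =>
    cases d with
    | zero =>
      constructor
      · rintro x y ⟨⟩ i x' hx
        simp [hx₀] at hx
      · rintro x y ⟨⟩ i x' hx
        simp [hy₀] at hx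
    | succ d =>
      exact ⟨lifts_succ hB hC h₀ (fun m hm => (ih m (by omega)).1) fun m hm => (ih m (by omega)).2,
        lifts_succ hC hB (fun i => (h₀ i).symm) (fun m hm => (ih m (by omega)).2)
          fun m hm => (ih m (by omega)).1⟩

/-- Stembridge's uniqueness theorem: if every element of the first crystal lies below the highest
element `x₀`, then it maps to any second crystal in which some highest element has the same weight
as `x₀`. -/
theorem IsStembridge.exists_hom (hB : IsStembridge A e f ε φ) (hC : IsStembridge A e' f' ε' φ')
    (hx₀ : ∀ i, e i x₀ = none) (hy₀ : ∀ i, e' i y₀ = none)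
    (h₀ : ∀ i, φ i x₀ - ε i x₀ = φ' i y₀ - ε' i y₀)
    (hreach : ∀ x, Relation.ReflTransGen (fun x y => ∃ i, f i x = some y) x₀ x) :
    ∃ θ : B → C, θ x₀ = y₀ ∧ ∀ i x, (e i x).map θ = e' i (θ x) ∧ (f i x).map θ = f' i (θ x) := by
  have L := lifts_all hB hC hx₀ hy₀ h₀
  have L₁ : ∀ d, ∀ m ≤ d, Lifts e f e' f' x₀ y₀ m := fun _ m _ => (L m).1
  have L₂ : ∀ d, ∀ m ≤ d, Lifts e' f' e f y₀ x₀ m := fun _ m _ => (L m).2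
  have hex : ∀ x, ∃ y d, ParallelPath f f' x₀ y₀ d x y := by
    intro x
    induction hreach x with
    | refl => exact ⟨y₀, 0, .refl⟩
    | tail _ h ih =>
      obtain ⟨i, hi⟩ := h
      obtain ⟨y, d, hd⟩ := ih
      obtain ⟨y', hy'⟩ := exists_f_of_lifts hB hC h₀ (L₁ d) (L₂ d) hd hi
      exact ⟨y', d + 1, hd.step i hi hy'⟩
  have huniq : ∀ d x y, ParallelPath f f' x₀ y₀ d x y → ∀ d' y',
      ParallelPath f f' x₀ y₀ d' x y' → y = y' := by
    intro d x y h
    induction h with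
    | refl =>
      intro d' y' h'
      cases h' with
      | refl => rfl
      | step i _ hi _ => simpa [hx₀] using (hB.f_iff_e _ _ _).1 hi
    | step i _ hx hy ih =>
      intro d' y' h'
      obtain ⟨d'', z, -, hz, hz'⟩ := (L d').1 _ _ h' i _ ((hB.f_iff_e _ _ _).1 hx)
      obtain rfl := ih _ _ hz
      simpa [hy] using (hC.f_iff_e _ _ _).2 hz'
  choose θ D hθ using hex
  refine ⟨θ, huniq _ _ _ (hθ x₀) 0 _ .refl, fun i x => ⟨?_, ?_⟩⟩
  · rcases hx : e i x with _ | x'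
    · rw [Option.map_none, eq_comm, hC.e_eq_none,
        ← eps_eq_of_lifts hB hC (L₁ _) (L₂ _) (hθ x), ← hB.e_eq_none, hx]
    · obtain ⟨d', y', -, h', hy'⟩ := (L (D x)).1 _ _ (hθ x) i x' hx
      rw [hy', Option.map_some, huniq _ _ _ (hθ x') _ _ h']
  · rcases hx : f i x with _ | x'
    · rw [Option.map_none, eq_comm, hC.f_eq_none,
        ← phi_eq_of_lifts hB hC h₀ (L₁ _) (L₂ _) (hθ x), ← hB.f_eq_none, hx]
    · obtain ⟨y', hy'⟩ := exists_f_of_lifts hB hC h₀ (L₁ _) (L₂ _) (hθ x) hx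
      rw [hy', Option.map_some, huniq _ _ _ (hθ x') _ _ ((hθ x).step i hx hy')]
end

/-! ### Stembridge's axioms from axioms on raising operators -/

/-- The dual crystal, with raising and lowering operators exchanged. -/
theorem IsSeminormal.dual {I B : Type*} {A : I → I → ℤ} {e f : I → B → Option B}
    {ε φ : I → B → ℤ} (h : IsSeminormal A e f ε φ) : IsSeminormal A f e φ ε where
  f_iff_e i x y := (h.f_iff_e i y x).symm
  eps_nonneg := h.phi_nonneg
  phi_nonneg := h.eps_nonneg
  e_eq_none := h.f_eq_none
  f_eq_none := h.e_eq_none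
  eps_e i x y hxy := by
    have h1 := h.wt_f i x y hxy i
    have h2 := h.eps_e i y x ((h.f_iff_e i x y).1 hxy)
    rw [h.diag] at h1
    omega
  wt_f j x y hxy i := by
    have := h.wt_f j y x ((h.f_iff_e j y x).2 hxy) i
    omega
  diag := h.diag

theorem IsSeminormal.exists_e {I B : Type*} {A : I → I → ℤ} {e f : I → B → Option B}
    {ε φ : I → B → ℤ} (h : IsSeminormal A e f ε φ) {i : I} {x : B} (hx : 0 < ε i x) :
    ∃ y, e i x = some y := by
  rw [← Option.ne_none_iff_exists', Ne, h.e_eq_none]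
  omega

theorem IsSeminormal.eps_pos {I B : Type*} {A : I → I → ℤ} {e f : I → B → Option B}
    {ε φ : I → B → ℤ} (h : IsSeminormal A e f ε φ) {i : I} {x y : B} (hx : e i x = some y) :
    0 < ε i x := by
  have := h.eps_e i x y hx
  have := h.eps_nonneg i y
  omega

/-- The colors `i` and `j` are orthogonal and act independently, or they span a root system of type
`A₂` and satisfy the local axioms for that type. -/
def IsLocalPair {I B : Type*} (A : I → I → ℤ) (e : I → B → Option B) (ε : I → B → ℤ)
    (i j : I) : Prop :=
  (A i j = 0 ∧ A j i = 0 ∧ (∀ x z, e i x = some z → ε j z = ε j x) ∧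
    (∀ x v, e j x = some v → ε i v = ε i x) ∧
    ∀ x z v, e i x = some z → e j x = some v → ∃ y, e j z = some y ∧ e i v = some y) ∨
  (A i j = -1 ∧ A j i = -1 ∧ ∀ x, IsLocalA2At (e i) (e j) (ε i) (ε j) x)

theorem IsLocalPair.symm {I B : Type*} {A : I → I → ℤ} {e : I → B → Option B} {ε : I → B → ℤ}
    {i j : I} (h : IsLocalPair A e ε i j) : IsLocalPair A e ε j i := by
  rcases h with ⟨h1, h2, h3, h4, h5⟩ | ⟨h1, h2, h3⟩
  · exact Or.inl ⟨h2, h1, h4, h3, fun x z v hz hv => (h5 x v z hv hz).imp fun _ => And.symm⟩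
  · exact Or.inr ⟨h2, h1, fun x => (h3 x).symm⟩

section
variable {I B : Type*} {A : I → I → ℤ} {e f : I → B → Option B} {ε φ : I → B → ℤ}

theorem IsSeminormal.up (h : IsSeminormal A e f ε φ) {i j : I}
    (hij : IsLocalPair A e ε i j) (x z v : B) (hz : e i x = some z) (hv : e j x = some v) :
    (∃ y, e j z = some y ∧ e i v = some y ∧ (A i j = 0 ∨ φ i z = φ i y ∨ φ j v = φ j y)) ∨
    (A i j ≠ 0 ∧ ∃ z₁ z₂ v₁ v₂ y,
      (e j z = some z₁ ∧ e j z₁ = some z₂ ∧ e i z₂ = some y ∧ φ j z₂ = φ j y + 1) ∧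
      (e i v = some v₁ ∧ e i v₁ = some v₂ ∧ e j v₂ = some y ∧ φ i v₂ = φ i y + 1)) := by
  have hxz := h.eps_e _ _ _ hz
  have hxv := h.eps_e _ _ _ hv
  rcases hij with ⟨h1, -, -, -, h2⟩ | ⟨h1, h2, h3⟩
  · obtain ⟨y, hy, hy'⟩ := h2 x z v hz hv
    exact Or.inl ⟨y, hy, hy', Or.inl h1⟩
  · have hx := h3 x
    have c1 := hx.left.eps_le z hz
    have c2 := hx.right.eps_le v hv
    have c3 := hx.not_both z v hz hv
    by_cases hc : ε j z = ε j x ∨ ε i v = ε i x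
    · left
      obtain ⟨y, hy, hy'⟩ := hx.square z v hz hv hc
      refine ⟨y, hy, hy', Or.inr ?_⟩
      have a1 := h.eps_e _ _ _ hy
      have a2 := h.eps_e _ _ _ hy'
      have a3 := h.wt_f _ _ _ ((h.f_iff_e _ _ _).2 hy) i
      have a4 := h.wt_f _ _ _ ((h.f_iff_e _ _ _).2 hy') j
      omega
    · right
      obtain ⟨z₁, z₂, v₁, v₂, y, ⟨b1, b2, b3, b4⟩, b5, b6, b7, b8⟩ :=
        hx.octagon z v hz hv (by omega) (by omega)
      have a1 := h.eps_e _ _ _ b1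
      have a2 := h.eps_e _ _ _ b2
      have a3 := h.eps_e _ _ _ b3
      have a5 := h.eps_e _ _ _ b5
      have a6 := h.eps_e _ _ _ b6
      have a7 := h.eps_e _ _ _ b7
      have a4 := h.wt_f _ _ _ ((h.f_iff_e _ _ _).2 b3) j
      have a8 := h.wt_f _ _ _ ((h.f_iff_e _ _ _).2 b7) i
      exact ⟨by omega, z₁, z₂, v₁, v₂, y, ⟨b1, b2, b3, by omega⟩, b5, b6, b7, by omega⟩

/-- The lower end of a commuting square. The axiom `turn` excludes that `e_i` raises `ε_j` at the
bottom of the square. -/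
theorem IsSeminormal.down_square_aux (h : IsSeminormal A e f ε φ) {i j : I}
    (hij : ∀ x, IsLocalA2At (e i) (e j) (ε i) (ε j) x) (hA : A j i = -1)
    {y z v : B} (hz : f j y = some z) (hv : f i y = some v) (hc : φ i z = φ i y) :
    ∃ x, f i z = some x ∧ f j v = some x := by
  have hwt := h.wt_f _ _ _ hz i
  have hpos := h.dual.eps_pos hv
  obtain ⟨x, hx⟩ := h.dual.exists_e (i := i) (x := z) (by omega)
  have hxz := (h.f_iff_e _ _ _).1 hx
  have hzy := (h.f_iff_e _ _ _).1 hz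
  have hzpos := h.eps_pos hzy
  have hle : ε j z = ε j x := by
    rcases (hij x).left.eps_le z hxz with h' | h'
    · exact h'
    · have := (hij x).left.turn z y hxz hzy h'
      omega
  obtain ⟨v', hv'⟩ := h.exists_e (i := j) (x := x) (by omega)
  obtain ⟨y', hy, hy'⟩ := (hij x).square z v' hxz hv' (Or.inl hle)
  obtain rfl : y = y' := by simpa [hzy] using hy
  obtain rfl : v = v' := by simpa [hv] using (h.f_iff_e _ _ _).2 hy'
  exact ⟨x, hx, (h.f_iff_e _ _ _).2 hv'⟩

theorem IsSeminormal.down_square (h : IsSeminormal A e f ε φ) {i j : I}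
    (hij : IsLocalPair A e ε i j) (y z v : B) (hz : f j y = some z) (hv : f i y = some v)
    (hc : A i j = 0 ∨ φ i z = φ i y ∨ φ j v = φ j y) :
    ∃ x, f i z = some x ∧ f j v = some x := by
  rcases hij with ⟨h1, h2, h3, h4, h5⟩ | ⟨h1, h2, h3⟩
  · have hwt := h.wt_f _ _ _ hz i
    have hpos := h.dual.eps_pos hv
    have hzy := (h.f_iff_e _ _ _).1 hz
    have := h4 _ _ hzy
    obtain ⟨x, hx⟩ := h.dual.exists_e (i := i) (x := z) (by omega)
    have hxz := (h.f_iff_e _ _ _).1 hx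
    have := h3 _ _ hxz
    have hzpos := h.eps_pos hzy
    obtain ⟨v', hv'⟩ := h.exists_e (i := j) (x := x) (by omega)
    obtain ⟨y', hy, hy'⟩ := h5 x z v' hxz hv'
    obtain rfl : y = y' := by simpa [hzy] using hy
    obtain rfl : v = v' := by simpa [hv] using (h.f_iff_e _ _ _).2 hy'
    exact ⟨x, hx, (h.f_iff_e _ _ _).2 hv'⟩
  · rcases hc with hc | hc | hc
    · omega
    · exact h.down_square_aux h3 h2 hz hv hc
    · exact (h.down_square_aux (fun x => (h3 x).symm) h1 hv hz hc).imp fun _ => And.symm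

/-- The degree four relation read from its top `y`, with the values of `ε` at its bottom `x`. -/
theorem IsSeminormal.down_octagon (h : IsSeminormal A e f ε φ) {i j : I}
    (hij : IsLocalPair A e ε i j) (hA : A i j ≠ 0) (y z₂ v₂ : B) (hz₂ : f i y = some z₂)
    (hv₂ : f j y = some v₂) (hc : φ j z₂ = φ j y + 1) (hc' : φ i v₂ = φ i y + 1) :
    ∃ z₁ z v₁ v x, (f j z₂ = some z₁ ∧ f j z₁ = some z ∧ f i z = some x) ∧
      (f i v₂ = some v₁ ∧ f i v₁ = some v ∧ f j v = some x) ∧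
      ε j z = ε j x + 1 ∧ ε i v = ε i x + 1 := by
  obtain ⟨h1, h2, h3⟩ := hij.resolve_left fun h => hA h.1
  have E : ∀ {i x y}, f i x = some y → e i y = some x := fun {i x y} => (h.f_iff_e i x y).1
  have F : ∀ {i x y}, e i y = some x → f i x = some y := fun {i x y} => (h.f_iff_e i x y).2
  have p1 := h.dual.eps_pos hz₂
  have p2 := h.dual.eps_pos hv₂
  have w1 := h.wt_f _ _ _ hz₂ j
  have w2 := h.wt_f _ _ _ hv₂ i
  have w1' := h.wt_f _ _ _ hz₂ i
  have s1 := h.eps_e _ _ _ (E hz₂)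
  have s2 := h.eps_e _ _ _ (E hv₂)
  have n0 := h.eps_nonneg i y
  have n1 := h.eps_nonneg j y
  obtain ⟨z₁, hz₁⟩ := h.dual.exists_e (i := j) (x := z₂) (by omega)
  have s3 := h.eps_e _ _ _ (E hz₁)
  have s3' := h.dual.eps_e _ _ _ hz₁
  have w3 := h.wt_f _ _ _ hz₁ i
  obtain ⟨z, hz⟩ := h.dual.exists_e (i := j) (x := z₁) (by omega)
  have s4 := h.eps_e _ _ _ (E hz)
  have w4 := h.wt_f _ _ _ hz i
  have hd := h.diag i
  -- a square with bottom `z₁` and top `y` would have `v₂` as its fourth corner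
  have key : ∀ p, e i z₁ = some p → ε j p = ε j z₁ ∨ ε i z₂ = ε i z₁ → p = v₂ := by
    intro p hp hor
    obtain ⟨y', hy, hy'⟩ := (h3 z₁).square p z₂ hp (E hz₁) hor
    obtain rfl : y = y' := by simpa [E hz₂] using hy'
    simpa [hv₂, eq_comm] using F hy
  have t1 : ε i z₁ = ε i y := by
    rcases (h3 z₁).right.eps_le z₂ (E hz₁) with h' | h'
    · obtain ⟨p, hp⟩ := h.exists_e (i := i) (x := z₁) (by omega)
      obtain rfl := key p hp (Or.inr h')
      have := (h3 z₁).not_both _ _ hp (E hz₁)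
      omega
    · omega
  have t2 : ε i z = ε i y := by
    rcases (h3 z).right.eps_le z₁ (E hz) with h' | h'
    · omega
    · have := h.eps_nonneg i z
      obtain ⟨p, hp⟩ := h.exists_e (i := i) (x := z₁) (by omega)
      obtain rfl := key p hp (Or.inl ((h3 z).right.turn _ _ (E hz) hp h'))
      have := h.eps_e _ _ _ hp
      omega
  obtain ⟨x, hx⟩ := h.dual.exists_e (i := i) (x := z) (by omega)
  have s5 := h.eps_e _ _ _ (E hx)
  have l1 := (h3 x).left.eps_le z (E hx)
  obtain ⟨v, hv⟩ := h.exists_e (i := j) (x := x) (by omega)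
  have s6 := h.eps_e _ _ _ hv
  have l2 := (h3 x).right.eps_le v hv
  have t3 : ε j z = ε j x + 1 ∧ ε i v = ε i x + 1 := by
    by_contra hcon
    obtain ⟨y', hy, hy'⟩ := (h3 x).square z v (E hx) hv (by omega)
    obtain rfl : z₁ = y' := by simpa [E hz] using hy
    have := h.eps_e _ _ _ hy'
    have := (h3 x).not_both _ _ (E hx) hv
    have := (h3 v).left.turn z₁ z₂ hy' (E hz₁) (by omega)
    omega
  obtain ⟨a₁, a₂, v₁, b₂, y', ⟨b1, b2, b3, -⟩, b5, b6, b7, -⟩ :=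
    (h3 x).octagon z v (E hx) hv t3.1 t3.2
  obtain rfl : z₁ = a₁ := by simpa [E hz] using b1
  obtain rfl : z₂ = a₂ := by simpa [E hz₁] using b2
  obtain rfl : y = y' := by simpa [E hz₂] using b3
  obtain rfl : v₂ = b₂ := by simpa [hv₂] using F b7
  exact ⟨z₁, z, v₁, v, x, ⟨hz₁, hz, hx⟩, ⟨F b6, F b5, F hv⟩, t3⟩

theorem IsSeminormal.dual_up (h : IsSeminormal A e f ε φ) {i j : I}
    (hij : IsLocalPair A e ε i j) (x z v : B) (hz : f i x = some z) (hv : f j x = some v) :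
    (∃ y, f j z = some y ∧ f i v = some y ∧ (A i j = 0 ∨ ε i z = ε i y ∨ ε j v = ε j y)) ∨
    (A i j ≠ 0 ∧ ∃ z₁ z₂ v₁ v₂ y,
      (f j z = some z₁ ∧ f j z₁ = some z₂ ∧ f i z₂ = some y ∧ ε j z₂ = ε j y + 1) ∧
      (f i v = some v₁ ∧ f i v₁ = some v₂ ∧ f j v₂ = some y ∧ ε i v₂ = ε i y + 1)) := by
  have E : ∀ {i x y}, f i x = some y → e i y = some x := fun {i x y} => (h.f_iff_e i x y).1
  by_cases hA : A i j = 0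
  · obtain ⟨y, hy, hy'⟩ := h.down_square hij x v z hv hz (Or.inl hA)
    exact Or.inl ⟨y, hy', hy, Or.inl hA⟩
  obtain ⟨h1, h2, h3⟩ := hij.resolve_left fun h => hA h.1
  have w1 := h.wt_f _ _ _ hz j
  have w2 := h.wt_f _ _ _ hv i
  have l1 := (h3 z).left.eps_le x (E hz)
  have l2 := (h3 v).right.eps_le x (E hv)
  by_cases hc : φ j z = φ j x ∨ φ i v = φ i x
  · obtain ⟨y, hy, hy'⟩ := h.down_square hij x v z hv hz (Or.inr hc.symm)
    refine Or.inl ⟨y, hy', hy, Or.inr ?_⟩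
    have l3 := (h3 y).left.eps_le v (E hy)
    have l4 := (h3 y).right.eps_le z (E hy')
    have t1 := (h3 y).left.turn v x (E hy) (E hv)
    have t2 := (h3 y).right.turn z x (E hy') (E hz)
    omega
  · obtain ⟨z₁, z₂, v₁, v₂, y, ⟨b1, b2, b3⟩, ⟨b4, b5, b6⟩, b7, b8⟩ :=
      h.down_octagon hij hA x z v hz hv (by omega) (by omega)
    exact Or.inr ⟨hA, z₁, z₂, v₁, v₂, y, ⟨b1, b2, b3, b7⟩, b4, b5, b6, b8⟩

/-- Rank two axioms on raising operators imply Stembridge's axioms. -/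
theorem IsSeminormal.isStembridge (h : IsSeminormal A e f ε φ)
    (hloc : ∀ i j, i ≠ j → IsLocalPair A e ε i j) : IsStembridge A e f ε φ where
  toIsSeminormal := h
  up i j hij := h.up (hloc i j hij)
  down_square i j hij := h.down_square (hloc i j hij)
  down_octagon i j hij hA y z₂ v₂ hz hv hc hc' := by
    obtain ⟨z₁, z, v₁, v, x, h1, h2, -⟩ := h.down_octagon (hloc i j hij) hA y z₂ v₂ hz hv hc hc'
    exact ⟨z₁, z, v₁, v, x, h1, h2⟩

/-- Rank two axioms on raising operators imply Stembridge's axioms for the dual crystal. -/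
theorem IsSeminormal.isStembridge_dual (h : IsSeminormal A e f ε φ)
    (hloc : ∀ i j, i ≠ j → IsLocalPair A e ε i j) : IsStembridge A f e φ ε where
  toIsSeminormal := h.dual
  up i j hij := h.dual_up (hloc i j hij)
  down_square i j hij y z v hz hv hc := by
    rcases hloc i j hij with ⟨h1, h2, h3, h4, h5⟩ | ⟨h1, h2, h3⟩
    · exact (h5 y v z hv hz).imp fun _ => And.symm
    · exact ((h3 y).square v z hv hz (by omega)).imp fun _ => And.symm
  down_octagon i j hij hA y z₂ v₂ hz hv hc hc' := by
    obtain ⟨h1, h2, h3⟩ := (hloc i j hij).resolve_left fun h => hA h.1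
    obtain ⟨z₁, z, v₁, v, x, ⟨a1, a2, a3, -⟩, b1, b2, b3, -⟩ := (h3 y).octagon z₂ v₂ hz hv hc hc'
    exact ⟨z₁, z, v₁, v, x, ⟨a1, a2, a3⟩, b1, b2, b3⟩
end

/-! ### Regular crystals -/

/-- `ε_i` as an integer, with the junk value `0` for `⊥`, which does not occur in regular
crystals. -/
def CrystalData.epsInt {n : ℕ} {B : Type*} (X : CrystalData n B) (i : ZMod n) (b : B) : ℤ :=
  (X.ε i b).unbotD 0

/-- `φ_i` as an integer, with the junk value `0` for `⊥`, which does not occur in regular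
crystals. -/
def CrystalData.phiInt {n : ℕ} {B : Type*} (X : CrystalData n B) (i : ZMod n) (b : B) : ℤ :=
  (X.φ i b).unbotD 0

theorem mem_component_self {n : ℕ} {B : Type*} (X : CrystalData n B) (J : Set (ZMod n)) (b : B) :
    b ∈ component X J b := Relation.EqvGen.refl b

theorem mem_component_of_e {n : ℕ} {B : Type*} {X : CrystalData n B} (hX : IsCrystal X)
    {J : Set (ZMod n)} {b x y : B} {i : ZMod n} (hi : i ∈ J) (hx : x ∈ component X J b)
    (h : X.e i x = some y) : y ∈ component X J b :=
  hx.trans _ _ _ (.symm _ _ (.rel _ _ ⟨i, hi, (hX.f_iff_e _ _ _).2 h⟩))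

/-- The local `A₂` axioms pull back along embeddings. -/
theorem IsLocalA2At.of_embedding {B C : Type*} {e₁ e₂ : B → Option B} {ε₁ ε₂ : B → ℤ}
    {e₁' e₂' : C → Option C} {ε₁' ε₂' : C → ℤ} {S : Set B} {ψ : B → C} (hψ : S.InjOn ψ)
    (hS₁ : ∀ x ∈ S, ∀ y, e₁ x = some y → y ∈ S) (hS₂ : ∀ x ∈ S, ∀ y, e₂ x = some y → y ∈ S)
    (he₁ : ∀ x ∈ S, e₁' (ψ x) = (e₁ x).map ψ) (he₂ : ∀ x ∈ S, e₂' (ψ x) = (e₂ x).map ψ)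
    (hε₁ : ∀ x ∈ S, ε₁' (ψ x) = ε₁ x) (hε₂ : ∀ x ∈ S, ε₂' (ψ x) = ε₂ x) {x : B} (hx : x ∈ S)
    (h : IsLocalA2At e₁' e₂' ε₁' ε₂' (ψ x)) : IsLocalA2At e₁ e₂ ε₁ ε₂ x := by
  have E₁ : ∀ {x y}, x ∈ S → e₁ x = some y → e₁' (ψ x) = some (ψ y) := fun hx h => by
    rw [he₁ _ hx, h, Option.map_some]
  have E₂ : ∀ {x y}, x ∈ S → e₂ x = some y → e₂' (ψ x) = some (ψ y) := fun hx h => by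
    rw [he₂ _ hx, h, Option.map_some]
  have F₁ : ∀ {x y'}, x ∈ S → e₁' (ψ x) = some y' → ∃ y ∈ S, e₁ x = some y ∧ ψ y = y' :=
    fun {x y'} hx h => by
      rw [he₁ _ hx, Option.map_eq_some_iff] at h
      obtain ⟨y, hy, rfl⟩ := h
      exact ⟨y, hS₁ _ hx _ hy, hy, rfl⟩
  have F₂ : ∀ {x y'}, x ∈ S → e₂' (ψ x) = some y' → ∃ y ∈ S, e₂ x = some y ∧ ψ y = y' :=
    fun {x y'} hx h => by
      rw [he₂ _ hx, Option.map_eq_some_iff] at h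
      obtain ⟨y, hy, rfl⟩ := h
      exact ⟨y, hS₂ _ hx _ hy, hy, rfl⟩
  refine ⟨⟨fun z hz => ?_, fun y z hy hz => ?_, fun y z hy hz => ?_⟩,
    ⟨fun z hz => ?_, fun y z hy hz => ?_, fun y z hy hz => ?_⟩, fun z v hz hv => ?_,
    fun z v hz hv => ?_, fun z v hz hv => ?_⟩
  · have hzS := hS₁ _ hx _ hz
    rw [← hε₂ z hzS, ← hε₂ x hx]
    exact h.left.eps_le _ (E₁ hx hz)
  · have hyS := hS₁ _ hx _ hy
    have hzS := hS₁ _ hyS _ hz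
    rw [← hε₂ z hzS, ← hε₂ x hx, ← hε₂ y hyS]
    exact h.left.convex _ _ (E₁ hx hy) (E₁ hyS hz)
  · have hyS := hS₁ _ hx _ hy
    have hzS := hS₂ _ hyS _ hz
    rw [← hε₂ x hx, ← hε₂ y hyS, ← hε₁ z hzS, ← hε₁ y hyS]
    exact h.left.turn _ _ (E₁ hx hy) (E₂ hyS hz)
  · have hzS := hS₂ _ hx _ hz
    rw [← hε₁ z hzS, ← hε₁ x hx]
    exact h.right.eps_le _ (E₂ hx hz)
  · have hyS := hS₂ _ hx _ hy
    have hzS := hS₂ _ hyS _ hz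
    rw [← hε₁ z hzS, ← hε₁ x hx, ← hε₁ y hyS]
    exact h.right.convex _ _ (E₂ hx hy) (E₂ hyS hz)
  · have hyS := hS₂ _ hx _ hy
    have hzS := hS₁ _ hyS _ hz
    rw [← hε₁ x hx, ← hε₁ y hyS, ← hε₂ z hzS, ← hε₂ y hyS]
    exact h.right.turn _ _ (E₂ hx hy) (E₁ hyS hz)
  · have hzS := hS₁ _ hx _ hz
    have hvS := hS₂ _ hx _ hv
    rw [← hε₂ z hzS, ← hε₂ x hx, ← hε₁ v hvS, ← hε₁ x hx]
    exact h.not_both _ _ (E₁ hx hz) (E₂ hx hv)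
  · have hzS := hS₁ _ hx _ hz
    have hvS := hS₂ _ hx _ hv
    rw [← hε₂ z hzS, ← hε₂ x hx, ← hε₁ v hvS, ← hε₁ x hx]
    intro hc
    obtain ⟨y', c1, c2⟩ := h.square _ _ (E₁ hx hz) (E₂ hx hv) hc
    obtain ⟨y, hyS, hy, rfl⟩ := F₂ hzS c1
    obtain ⟨y₁, hyS', hy', he⟩ := F₁ hvS c2
    exact ⟨y, hy, by rw [hy', hψ hyS' hyS he]⟩
  · have hzS := hS₁ _ hx _ hz
    have hvS := hS₂ _ hx _ hv
    rw [← hε₂ z hzS, ← hε₂ x hx, ← hε₁ v hvS, ← hε₁ x hx]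
    intro hc hc'
    obtain ⟨z₁', z₂', v₁', v₂', y', ⟨c1, c2, c3, b4⟩, c5, c6, c7, b8⟩ :=
      h.octagon _ _ (E₁ hx hz) (E₂ hx hv) hc hc'
    obtain ⟨z₁, hz₁, b1, rfl⟩ := F₂ hzS c1
    obtain ⟨z₂, hz₂, b2, rfl⟩ := F₂ hz₁ c2
    obtain ⟨y, hyS, b3, rfl⟩ := F₁ hz₂ c3
    obtain ⟨v₁, hv₁, b5, rfl⟩ := F₁ hvS c5
    obtain ⟨v₂, hv₂, b6, rfl⟩ := F₁ hv₁ c6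
    obtain ⟨y₁, hyS', b7, he⟩ := F₂ hv₂ c7
    rw [hψ hyS' hyS he] at b7
    rw [hε₁ _ hz₂] at b4
    rw [hε₂ _ hv₂] at b8
    exact ⟨z₁, z₂, v₁, v₂, y, ⟨b1, b2, b3, b4⟩, b5, b6, b7, b8⟩

theorem simpleRoot_self {n : ℕ} [Fact (1 < n)] (i : ZMod n) : simpleRoot n i i = 2 := by
  simp [simpleRoot, eq_sub_iff_add_eq]

theorem simpleRoot_of_not_adj {n : ℕ} {i j : ZMod n} (hij : i ≠ j) (h1 : j ≠ i + 1)
    (h2 : i ≠ j + 1) : simpleRoot n i j = 0 := by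
  simp [simpleRoot, eq_sub_iff_add_eq, hij.symm, h1, h2.symm]

theorem simpleRoot_succ {n : ℕ} [Fact (1 < n)] {i : ZMod n} (hi : i + 1 + 1 ≠ i) :
    simpleRoot n i (i + 1) = -1 ∧ simpleRoot n (i + 1) i = -1 := by
  simp [simpleRoot, eq_sub_iff_add_eq, hi, hi.symm]

theorem simpleRoot_reflect {n : ℕ} (k i j : ZMod n) :
    simpleRoot n (k - i) (k - j) = simpleRoot n i j := by
  have h1 : k - j = k - i ↔ j = i := by simp
  have h2 : k - j = k - i + 1 ↔ j = i - 1 := by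
    constructor <;> intro h <;> linear_combination -h
  have h3 : k - j = k - i - 1 ↔ j = i + 1 := by
    constructor <;> intro h <;> linear_combination -h
  simp only [simpleRoot, h1, h2, h3]
  ring

/-- For `n = 2` the only pair of neighbouring colors is all of `I`. -/
theorem succ_succ_ne_of_pair_ne_univ {n : ℕ} [Fact (1 < n)] {i : ZMod n}
    (h : ({i, i + 1} : Set (ZMod n)) ≠ Set.univ) : i + 1 + 1 ≠ i := by
  intro h2
  apply h
  have h3 : ((2 : ℕ) : ZMod n) = 0 := by
    push_cast
    linear_combination h2
  rw [ZMod.natCast_eq_zero_iff] at h3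
  obtain rfl : n = 2 := by
    have := Nat.le_of_dvd (by norm_num) h3
    have : 1 < n := Fact.out
    omega
  rw [Set.eq_univ_iff_forall]
  simp only [Set.mem_insert_iff, Set.mem_singleton_iff]
  clear h h2 h3
  revert i
  decide

section
variable {n : ℕ} [Fact (1 < n)] {B : Type*} {X : CrystalData n B}

theorem IsRegularCrystal.exists_word (hR : IsRegularCrystal X) (i : ZMod n) (b : B) :
    ∃ w : List (ZMod n), X.ε i b = (wordEps n i w : WithBot ℤ) ∧
      X.φ i b = (wordPhi n i w : WithBot ℤ) ∧ (X.e i b = none ↔ wordE n i w = none) ∧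
      (X.f i b = none ↔ wordF n i w = none) := by
  have hne : ({i, i} : Set (ZMod n)) ≠ Set.univ := by
    intro h
    have : i + 1 ∈ ({i, i} : Set (ZMod n)) := h ▸ Set.mem_univ _
    simp at this
  obtain ⟨mu, ψ, -, H⟩ := hR i i hne b
  have hb := mem_component_self X {i, i} b
  have hi : i ∈ ({i, i} : Set (ZMod n)) := by simp
  refine ⟨ψ b, (H.ε i hi b hb).symm, (H.φ i hi b hb).symm, ?_, ?_⟩
  · have := H.e i hi b hb
    simp only [wordCrystal] at this
    rw [this, Option.map_eq_none_iff]
  · have := H.f i hi b hb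
    simp only [wordCrystal] at this
    rw [this, Option.map_eq_none_iff]

theorem IsRegularCrystal.eps_eq (hR : IsRegularCrystal X) (i : ZMod n) (b : B) :
    X.ε i b = (X.epsInt i b : WithBot ℤ) := by
  obtain ⟨w, h, -⟩ := hR.exists_word i b
  simp [CrystalData.epsInt, h]

theorem IsRegularCrystal.phi_eq (hR : IsRegularCrystal X) (i : ZMod n) (b : B) :
    X.φ i b = (X.phiInt i b : WithBot ℤ) := by
  obtain ⟨w, -, h, -⟩ := hR.exists_word i b
  simp [CrystalData.phiInt, h]

theorem IsRegularCrystal.phiInt_eq (hX : IsCrystal X) (hR : IsRegularCrystal X) (i : ZMod n)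
    (b : B) : X.phiInt i b = X.wt b i + X.epsInt i b := by
  have := hX.phi_eq i b
  rw [hR.eps_eq, hR.phi_eq] at this
  exact_mod_cast this

theorem IsRegularCrystal.isSeminormal (hX : IsCrystal X) (hR : IsRegularCrystal X) {I : Type*}
    (c : I → ZMod n) :
    IsSeminormal (fun i j => simpleRoot n (c i) (c j)) (fun i => X.e (c i)) (fun i => X.f (c i))
      (fun i => X.epsInt (c i)) (fun i => X.phiInt (c i)) where
  f_iff_e i := hX.f_iff_e (c i)
  eps_nonneg i b := by
    obtain ⟨w, h, -⟩ := hR.exists_word (c i) b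
    simpa [CrystalData.epsInt, h] using wordEps_nonneg n (c i) w
  phi_nonneg i b := by
    obtain ⟨w, -, h, -⟩ := hR.exists_word (c i) b
    simpa [CrystalData.phiInt, h] using wordPhi_nonneg n (c i) w
  e_eq_none i b := by
    obtain ⟨w, h, -, h', -⟩ := hR.exists_word (c i) b
    simp only [CrystalData.epsInt, h, h', wordE_eq_none_iff, WithBot.unbotD_coe]
  f_eq_none i b := by
    obtain ⟨w, -, h, -, h'⟩ := hR.exists_word (c i) b
    simp only [CrystalData.phiInt, h, h', wordF_eq_none_iff, WithBot.unbotD_coe]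
  eps_e i x y hxy := by
    have := hX.eps_e _ _ _ hxy
    rw [hR.eps_eq, hR.eps_eq] at this
    exact_mod_cast this
  wt_f j x y hxy i := by
    have h1 := IsRegularCrystal.phiInt_eq hX hR (c i) x
    have h2 := IsRegularCrystal.phiInt_eq hX hR (c i) y
    have h3 := congrFun (hX.wt_f _ _ _ hxy) (c i)
    simp only [Pi.sub_apply] at h3
    omega
  diag i := simpleRoot_self _

theorem IsRegularCrystal.isLocalPair_of_succ (hX : IsCrystal X) (hR : IsRegularCrystal X)
    {i : ZMod n} (h : ({i, i + 1} : Set (ZMod n)) ≠ Set.univ) :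
    IsLocalPair (simpleRoot n) X.e X.epsInt i (i + 1) := by
  have hi := succ_succ_ne_of_pair_ne_univ h
  refine Or.inr ⟨(simpleRoot_succ hi).1, (simpleRoot_succ hi).2, fun b => ?_⟩
  obtain ⟨mu, ψ, -, H⟩ := hR i (i + 1) h b
  have h0 : i ∈ ({i, i + 1} : Set (ZMod n)) := by simp
  have h1 : i + 1 ∈ ({i, i + 1} : Set (ZMod n)) := by simp
  have hε : ∀ j ∈ ({i, i + 1} : Set (ZMod n)), ∀ x ∈ component X {i, i + 1} b,
      wordEps n j (ψ x) = X.epsInt j x := by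
    intro j hj x hx
    have := H.ε j hj x hx
    rw [hR.eps_eq] at this
    exact WithBot.coe_injective this
  exact IsLocalA2At.of_embedding H.injOn
    (fun x hx y hy => mem_component_of_e hX h0 hx hy)
    (fun x hx y hy => mem_component_of_e hX h1 hx hy) (H.e i h0) (H.e _ h1) (hε i h0) (hε _ h1)
    (mem_component_self X _ b) (isLocalA2At_word i hi _ (ψ b) rfl)

theorem IsRegularCrystal.isLocalPair (hX : IsCrystal X) (hR : IsRegularCrystal X)
    {i j : ZMod n} (hij : i ≠ j) (h : ({i, j} : Set (ZMod n)) ≠ Set.univ) :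
    IsLocalPair (simpleRoot n) X.e X.epsInt i j := by
  by_cases h1 : j = i + 1
  · subst h1
    exact IsRegularCrystal.isLocalPair_of_succ hX hR h
  by_cases h2 : i = j + 1
  · subst h2
    rw [Set.pair_comm] at h
    exact (IsRegularCrystal.isLocalPair_of_succ hX hR h).symm
  have key : ∀ i j : ZMod n, i ≠ j → j ≠ i + 1 → i ≠ j + 1 → ({i, j} : Set (ZMod n)) ≠ Set.univ →
      ∀ x z, X.e i x = some z → X.epsInt j z = X.epsInt j x ∧
        ∀ v, X.e j x = some v → ∃ y, X.e j z = some y ∧ X.e i v = some y := by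
    intro i j hij h1 h2 h x z hz
    obtain ⟨mu, ψ, -, H⟩ := hR i j h x
    have hi : i ∈ ({i, j} : Set (ZMod n)) := by simp
    have hj : j ∈ ({i, j} : Set (ZMod n)) := by simp
    have hx := mem_component_self X {i, j} x
    have hzS := mem_component_of_e hX hi hx hz
    have hz' : wordE n i (ψ x) = some (ψ z) := (H.e i hi x hx).trans (by rw [hz]; rfl)
    constructor
    · have a1 := H.ε j hj x hx
      have a2 := H.ε j hj z hzS
      have a3 := wordEps_wordE_of_not_adj hij h1 h2 hz'
      simp only [wordCrystal] at a1 a2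
      simp [CrystalData.epsInt, ← a1, ← a2, a3]
    · intro v hv
      have hvS := mem_component_of_e hX hj hx hv
      have hv' : wordE n j (ψ x) = some (ψ v) := (H.e j hj x hx).trans (by rw [hv]; rfl)
      obtain ⟨y', c1, c2⟩ := wordE_comm_of_not_adj hij h1 h2 hz' hv'
      have b1 : (X.e j z).map ψ = some y' := (H.e j hj z hzS).symm.trans c1
      have b2 : (X.e i v).map ψ = some y' := (H.e i hi v hvS).symm.trans c2
      obtain ⟨y, hy, rfl⟩ := Option.map_eq_some_iff.1 b1
      obtain ⟨y₁, hy₁, he⟩ := Option.map_eq_some_iff.1 b2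
      rw [H.injOn (mem_component_of_e hX hi hvS hy₁) (mem_component_of_e hX hj hzS hy) he] at hy₁
      exact ⟨y, hy, hy₁⟩
  exact Or.inl ⟨simpleRoot_of_not_adj hij h1 h2, simpleRoot_of_not_adj hij.symm h2 h1,
    fun x z hz => (key i j hij h1 h2 h x z hz).1,
    fun x v hv => (key j i hij.symm h2 h1 (by rwa [Set.pair_comm]) x v hv).1,
    fun x z v hz hv => (key i j hij h1 h2 h x z hz).2 v hv⟩

theorem IsRegularCrystal.isLocalPair_comp (hX : IsCrystal X) (hR : IsRegularCrystal X)
    {I : Type*} {c : I → ZMod n} (hc : Function.Injective c) {k : ZMod n} (hk : ∀ i, c i ≠ k)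
    (i j : I) (hij : i ≠ j) :
    IsLocalPair (fun i j => simpleRoot n (c i) (c j)) (fun i => X.e (c i))
      (fun i => X.epsInt (c i)) i j := by
  refine IsRegularCrystal.isLocalPair hX hR (hc.ne hij) fun h => ?_
  have : k ∈ ({c i, c j} : Set (ZMod n)) := h ▸ Set.mem_univ _
  rcases this with h | h
  · exact hk i h.symm
  · exact hk j h.symm

/-- Let `x₀` be a highest weight element for the colors other than `0`, and `y₀` a lowest weight
element for the colors other than `k`. If their weights correspond under `i ↦ k - i` and `x₀`
generates the crystal, there is a map intertwining `e_i` and `f_{k-i}` for all `i ≠ 0`. -/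
theorem IsRegularCrystal.exists_reflection (hX : IsCrystal X) (hR : IsRegularCrystal X)
    {k : ZMod n} {x₀ y₀ : B} (hx₀ : ∀ i, i ≠ 0 → X.e i x₀ = none)
    (hy₀ : ∀ i, i ≠ k → X.f i y₀ = none) (h₀ : X.wt y₀ = longestWeyl n k (X.wt x₀))
    (hreach : ∀ x, Relation.ReflTransGen (fun x y => ∃ i, i ≠ 0 ∧ X.f i x = some y) x₀ x) :
    ∃ θ : B → B, (∀ x, X.wt (θ x) = longestWeyl n k (X.wt x)) ∧
      (∀ i, i ≠ 0 → ∀ x, (X.e i x).map θ = X.f (k - i) (θ x)) ∧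
      ∀ i, i ≠ 0 → ∀ x, (X.f i x).map θ = X.e (k - i) (θ x) := by
  let c : {i : ZMod n // i ≠ 0} → ZMod n := fun i => i
  let c' : {i : ZMod n // i ≠ 0} → ZMod n := fun i => k - i
  have hc : Function.Injective c := Subtype.val_injective
  have hc' : Function.Injective c' := fun i j h => Subtype.ext (sub_right_injective h)
  have S := (IsRegularCrystal.isSeminormal hX hR c).isStembridge
    (IsRegularCrystal.isLocalPair_comp hX hR hc fun i => i.2)
  have S' := (IsRegularCrystal.isSeminormal hX hR c').isStembridge_dual
    (IsRegularCrystal.isLocalPair_comp hX hR (k := k) hc' fun i => by simp [c', i.2])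
  have hA : (fun i j => simpleRoot n (c' i) (c' j)) = fun i j => simpleRoot n (c i) (c j) := by
    ext i j
    exact simpleRoot_reflect k _ _
  rw [hA] at S'
  obtain ⟨θ, hθ₀, hθ⟩ := S.exists_hom (x₀ := x₀) (y₀ := y₀) S' (fun i => hx₀ _ i.2)
    (fun i => hy₀ _ (by simp [c', i.2])) (fun i => by
      have h1 := IsRegularCrystal.phiInt_eq hX hR (c i) x₀
      have h2 := IsRegularCrystal.phiInt_eq hX hR (c' i) y₀
      have h3 : X.wt y₀ (c' i) = -X.wt x₀ (k - c' i) := congrFun h₀ (c' i)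
      have h4 : k - c' i = c i := by simp [c, c']
      rw [h4] at h3
      omega)
    (fun x => Relation.ReflTransGen.mono (fun _ _ ⟨i, hi, h⟩ => ⟨⟨i, hi⟩, h⟩) _ _ (hreach x))
  refine ⟨θ, fun x => ?_, fun i hi x => (hθ ⟨i, hi⟩ x).1, fun i hi x => (hθ ⟨i, hi⟩ x).2⟩
  induction hreach x with
  | refl => rw [hθ₀, h₀]
  | @tail x y _ h ih =>
    obtain ⟨i, hi, h⟩ := h
    have h1 := (hθ ⟨i, hi⟩ x).2
    have h2 : X.e (k - i) (θ x) = some (θ y) := by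
      simpa [c, c', h, eq_comm] using h1
    have h3 : ∀ j, simpleRoot n (k - i) j = simpleRoot n i (k - j) := fun j => by
      rw [← simpleRoot_reflect k i (k - j), sub_sub_cancel]
    rw [hX.wt_e _ _ _ h2, hX.wt_f _ _ _ h, ih, map_sub]
    ext j
    have h4 : longestWeyl n k (simpleRoot n i) j = -simpleRoot n i (k - j) := rfl
    rw [Pi.add_apply, Pi.sub_apply, h3, h4, sub_neg_eq_add]
end

/-! ### Highest weight rectangular tableaux -/

/-- The cells of the rectangle `(s^r)` in the order in which the entries of a tableau are read. -/
def readingCells (r s : ℕ) : List (ℕ × ℕ) :=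
  (List.range r).flatMap fun a => (List.range s).reverse.map fun b => (a, b)

/-- The cells read up to and including `q`. -/
def cellsUpTo (r s : ℕ) (q : ℕ × ℕ) : Finset (ℕ × ℕ) :=
  (Finset.range r ×ˢ Finset.range s).filter fun p => p.1 < q.1 ∨ p.1 = q.1 ∧ q.2 ≤ p.2

theorem mem_cellsUpTo {r s : ℕ} {p q : ℕ × ℕ} : p ∈ cellsUpTo r s q ↔
    (p.1 < r ∧ p.2 < s) ∧ (p.1 < q.1 ∨ p.1 = q.1 ∧ q.2 ≤ p.2) := by
  simp [cellsUpTo]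

theorem mem_readingCells {r s : ℕ} {p : ℕ × ℕ} : p ∈ readingCells r s ↔ p.1 < r ∧ p.2 < s := by
  obtain ⟨a, b⟩ := p
  simp [readingCells]

theorem pairwise_readingCells (r s : ℕ) :
    (readingCells r s).Pairwise fun p q => p.1 < q.1 ∨ p.1 = q.1 ∧ q.2 < p.2 := by
  rw [readingCells, List.pairwise_flatMap]
  constructor
  · intro a _
    rw [List.pairwise_map, List.pairwise_reverse]
    exact List.pairwise_lt_range.imp fun h => Or.inr ⟨rfl, h⟩
  · refine List.pairwise_lt_range.imp fun h p hp q hq => Or.inl ?_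
    simp only [List.mem_map] at hp hq
    obtain ⟨_, -, rfl⟩ := hp
    obtain ⟨_, -, rfl⟩ := hq
    exact h

theorem nodup_readingCells (r s : ℕ) : (readingCells r s).Nodup :=
  (pairwise_readingCells r s).imp fun h he => by
    subst he
    omega

theorem exists_prefix_readingCells {r s : ℕ} {q : ℕ × ℕ} (hq : q.1 < r ∧ q.2 < s) :
    ∃ l₁ l₂, readingCells r s = l₁ ++ l₂ ∧ l₁.Nodup ∧ ∀ p, p ∈ l₁ ↔ p ∈ cellsUpTo r s q := by
  obtain ⟨l₁, l₂, h⟩ := List.append_of_mem (mem_readingCells.2 hq)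
  have hp := pairwise_readingCells r s
  have hn := nodup_readingCells r s
  rw [h, List.pairwise_append, List.pairwise_cons] at hp
  refine ⟨l₁ ++ [q], l₂, by simp [h], ?_, fun p => ?_⟩
  · rw [h, show l₁ ++ q :: l₂ = (l₁ ++ [q]) ++ l₂ by simp] at hn
    exact hn.of_append_left
  · have hm := mem_readingCells (r := r) (s := s) (p := p)
    rw [h] at hm
    rw [mem_cellsUpTo, ← hm]
    simp only [List.mem_append, List.mem_cons, List.not_mem_nil, or_false]
    constructor
    · rintro (h1 | rfl)
      · exact ⟨Or.inl h1, by have := hp.2.2 p h1 q (by simp); omega⟩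
      · exact ⟨Or.inr (Or.inl rfl), by omega⟩
    · rintro ⟨h1 | h1 | h1, h2⟩
      · exact Or.inl h1
      · exact Or.inr h1
      · have := hp.2.1.1 p h1
        omega

section
variable {n r s : ℕ}

theorem readingWord_eq (T : RectTableau n r s) :
    readingWord T = (readingCells r s).map fun p => ((T.val p.1 p.2 : ℕ) : ZMod n) := by
  simp [readingWord, readingCells, List.map_flatMap, Function.comp_def]

theorem length_readingWord (T : RectTableau n r s) : (readingWord T).length = r * s := by
  simp [readingWord]

theorem natCast_zmod_inj {x y : ℕ} (hx : 1 ≤ x) (hxn : x ≤ n) (hy : 1 ≤ y) (hyn : y ≤ n)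
    (h : (x : ZMod n) = y) : x = y := by
  rw [ZMod.natCast_eq_natCast_iff, Nat.modEq_iff_dvd] at h
  obtain ⟨d, hd⟩ := h
  have h1 : (n : ℤ) * d < n * 1 := by omega
  have h2 : (n : ℤ) * (-1) < n * d := by omega
  have hn : (0 : ℤ) < n := by omega
  have h3 := lt_of_mul_lt_mul_left h1 hn.le
  have h4 := lt_of_mul_lt_mul_left h2 hn.le
  obtain rfl : d = 0 := by omega
  omega

theorem count_map_cells (T : RectTableau n r s) {l : List (ℕ × ℕ)} (hl : l.Nodup)
    {D : Finset (ℕ × ℕ)} (hD : ∀ p, p ∈ l ↔ p ∈ D) (hDr : ∀ p ∈ D, p.1 < r ∧ p.2 < s)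
    {c : ℕ} (hc : 1 ≤ c) (hcn : c ≤ n) :
    (l.map fun p => ((T.val p.1 p.2 : ℕ) : ZMod n)).count (c : ZMod n) =
      (D.filter fun p => T.val p.1 p.2 = c).card := by
  rw [List.count, List.countP_map, List.countP_eq_length_filter,
    ← List.toFinset_card_of_nodup (hl.filter _)]
  congr 1
  ext p
  simp only [List.mem_toFinset, List.mem_filter, hD, Finset.mem_filter, Function.comp_apply,
    beq_iff_eq]
  refine and_congr_right fun hp => ⟨fun h => ?_, fun h => by rw [h]⟩
  obtain ⟨h1, h2⟩ := hDr p hp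
  exact natCast_zmod_inj (T.2 _ h1 _ h2).1 (T.2 _ h1 _ h2).2 hc hcn h

theorem count_readingWord (T : RectTableau n r s) {c : ℕ} (hc : 1 ≤ c) (hcn : c ≤ n) :
    (readingWord T).count (c : ZMod n) =
      ((Finset.range r ×ˢ Finset.range s).filter fun p => T.val p.1 p.2 = c).card := by
  rw [readingWord_eq]
  exact count_map_cells T (nodup_readingCells r s)
    (fun p => by simp [mem_readingCells]) (fun p hp => by simpa using hp) hc hcn

theorem RectTableau.row_weak (T : RectTableau n r s) {a b b' : ℕ} (ha : a < r) (hb : b ≤ b')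
    (hb' : b' < s) : T.val a b ≤ T.val a b' :=
  T.val.row_weak_of_le hb (by
    rw [← YoungDiagram.mem_cells]
    simp [rectDiagram, ha, hb'])

theorem RectTableau.col_strict (T : RectTableau n r s) {a a' b : ℕ} (ha : a < a') (ha' : a' < r)
    (hb : b < s) : T.val a b < T.val a' b :=
  T.val.col_strict ha (by
    rw [← YoungDiagram.mem_cells]
    simp [rectDiagram, ha', hb])

theorem RectTableau.row_lt (T : RectTableau n r s) {a b : ℕ} (ha : a < r) (hb : b < s) :
    a + 1 ≤ T.val a b := by
  induction a with
  | zero => exact (T.2 0 ha b hb).1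
  | succ a ih =>
    have := ih (by omega)
    have := T.col_strict (Nat.lt_add_one a) ha hb
    omega

/-- `ε_i` bounds the excess of the letter `i + 1` over the letter `i` in initial segments. -/
theorem count_le_of_append [Fact (1 < n)] (i : ZMod n) (p q : List (ZMod n)) :
    (p.count (i + 1) : ℤ) - p.count i ≤ wordEps n i (p ++ q) := by
  have h1 : i ≠ i + 1 := by simp
  induction p with
  | nil => simpa using wordEps_nonneg n i q
  | cons a p ih =>
    have h0 := wordEps_nonneg n i (p ++ q)
    rw [List.cons_append, wordEps_cons, List.count_cons, List.count_cons]
    split_ifs with h2 h3 <;> simp_all <;> omega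

/-- The lattice property of words killed by `e_c`, on initial segments of the reading order. -/
theorem card_cellsUpTo_succ_le [Fact (1 < n)] (T : RectTableau n r s) {c : ℕ} (hc : 1 ≤ c)
    (hcn : c < n) (h : wordEps n c (readingWord T) = 0) {a b : ℕ} (ha : a < r) (hb : b < s) :
    ((cellsUpTo r s (a, b)).filter fun p => T.val p.1 p.2 = c + 1).card ≤
      ((cellsUpTo r s (a, b)).filter fun p => T.val p.1 p.2 = c).card := by
  obtain ⟨l₁, l₂, h1, h2, h3⟩ := exists_prefix_readingCells (q := (a, b)) ⟨ha, hb⟩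
  rw [readingWord_eq, h1, List.map_append] at h
  have h4 := count_le_of_append (c : ZMod n)
    (l₁.map fun p => ((T.val p.1 p.2 : ℕ) : ZMod n))
    (l₂.map fun p => ((T.val p.1 p.2 : ℕ) : ZMod n))
  have hr : ∀ p ∈ cellsUpTo r s (a, b), p.1 < r ∧ p.2 < s := fun p hp => (mem_cellsUpTo.1 hp).1
  have h5 := count_map_cells T h2 h3 hr hc hcn.le
  have h6 := count_map_cells T h2 h3 hr (c := c + 1) (by omega) (by omega)
  push_cast at h6
  omega

/-- In a tableau whose word is highest weight for the colors below `k`, the letters up to `k` fill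
their rows as in the superstandard tableau. -/
theorem entry_eq_of_le [Fact (1 < n)] (T : RectTableau n r s) {k : ℕ} (hk : k ≤ n)
    (h : ∀ c : ℕ, 1 ≤ c → c < k → wordEps n c (readingWord T) = 0) {a b : ℕ} (ha : a < r)
    (hb : b < s) (hT : T.val a b ≤ k) : T.val a b = a + 1 := by
  induction a using Nat.strong_induction_on generalizing b with
  | _ a ih =>
    have h1 := T.row_lt ha hb
    by_contra hne
    obtain ⟨c, hc⟩ : ∃ c, T.val a b = c + 1 := ⟨T.val a b - 1, by omega⟩
    have h2 := card_cellsUpTo_succ_le T (c := c) (by omega) (by omega) (h c (by omega) (by omega))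
      ha hb
    have h3 : 0 < ((cellsUpTo r s (a, b)).filter fun p => T.val p.1 p.2 = c).card := by
      refine lt_of_lt_of_le (Finset.card_pos.2 ⟨(a, b), ?_⟩) h2
      simp [mem_cellsUpTo, ha, hb, hc]
    obtain ⟨p, hp⟩ := Finset.card_pos.1 h3
    rw [Finset.mem_filter, mem_cellsUpTo] at hp
    obtain ⟨⟨⟨hp1, hp2⟩, hp3⟩, hp4⟩ := hp
    simp only at hp3
    rcases hp3 with hp3 | ⟨hp3, hp5⟩
    · have := ih p.1 hp3 hp1 hp2 (by omega)
      omega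
    · have := T.row_weak ha hp5 hp2
      rw [hp3] at hp4
      omega

/-- In a tableau whose word is highest weight for the colors above `k`, the letters above `k` are
consecutive in each column. This uses that all columns of the shape end in the same row. -/
theorem entry_eq_of_lt [Fact (1 < n)] (T : RectTableau n r s) {k : ℕ}
    (h : ∀ c : ℕ, k < c → c < n → wordEps n c (readingWord T) = 0) {a b : ℕ} (ha : a < r)
    (hb : b < s) (hT : k < T.val a b) :
    T.val a b = if 1 ≤ a ∧ k < T.val (a - 1) b then T.val (a - 1) b + 1 else k + 1 := by
  induction a using Nat.strong_induction_on generalizing b with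
  | _ a ih =>
    obtain ⟨m, hm⟩ : ∃ m, m = s - b := ⟨_, rfl⟩
    induction m using Nat.strong_induction_on generalizing b with
    | _ m ihm =>
      have hcol : 1 ≤ a → T.val (a - 1) b < T.val a b := fun h1 =>
        T.col_strict (by omega) ha hb
      by_contra hne
      -- the first letter in the reading order that is too large
      obtain ⟨c, hc⟩ : ∃ c, T.val a b = c + 1 := ⟨T.val a b - 1, by omega⟩
      have hck : k < c := by
        split_ifs at hne <;> omega
      have hprev : 1 ≤ a → T.val (a - 1) b < c := by
        intro h1
        have := hcol h1
        split_ifs at hne with h2 <;> omega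
      have hcn : c < n := by
        have := (T.2 a ha b hb).2
        omega
      have h2 := card_cellsUpTo_succ_le T (c := c) (by omega) hcn (h c hck hcn) ha hb
      -- below each earlier `c` there is an earlier `c + 1`
      have h3 : ((cellsUpTo r s (a, b)).filter fun p => T.val p.1 p.2 = c).card ≤
          (((cellsUpTo r s (a, b)).filter fun p => T.val p.1 p.2 = c + 1).erase (a, b)).card := by
        refine Finset.card_le_card_of_injOn (fun p => (p.1 + 1, p.2)) ?_ ?_
        · rintro ⟨a', b'⟩ hp
          rw [Finset.mem_coe, Finset.mem_filter, mem_cellsUpTo] at hp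
          obtain ⟨⟨⟨hp1, hp2⟩, hp3⟩, hp4⟩ := hp
          simp only at hp1 hp2 hp3 hp4
          have ha' : a' < a := by
            rcases hp3 with hp3 | ⟨rfl, hp5⟩
            · exact hp3
            · have := T.row_weak ha hp5 hp2
              omega
          have hb' : a' + 1 = a → b < b' := by
            intro he
            by_contra hle
            have := T.row_weak hp1 (not_lt.1 hle) hb
            have := hprev (by omega)
            rw [show a - 1 = a' by omega] at this
            omega
          have hlt : k < T.val (a' + 1) b' := by
            have := T.col_strict (Nat.lt_add_one a') (by omega) hp2
            omega
          have hval : T.val (a' + 1) b' = c + 1 := by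
            have : T.val (a' + 1) b' = if 1 ≤ a' + 1 ∧ k < T.val (a' + 1 - 1) b'
                then T.val (a' + 1 - 1) b' + 1 else k + 1 := by
              by_cases he : a' + 1 = a
              · have := hb' he
                subst he
                exact ihm (s - b') (by omega) hp2 hlt rfl
              · exact ih (a' + 1) (by omega) (by omega) hp2 hlt
            rw [this, if_pos ⟨by omega, by simpa [hp4] using hck⟩]
            simp [hp4]
          simp only [Finset.coe_erase, Set.mem_sdiff, Finset.mem_coe, Finset.mem_filter,
            mem_cellsUpTo, Set.mem_singleton_iff, Prod.mk.injEq]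
          refine ⟨⟨⟨⟨by omega, hp2⟩, ?_⟩, hval⟩, ?_⟩
          · by_cases he : a' + 1 = a
            · exact Or.inr ⟨he, (hb' he).le⟩
            · exact Or.inl (by omega)
          · rintro ⟨he, rfl⟩
            exact lt_irrefl _ (hb' he)
        · rintro ⟨a', b'⟩ - ⟨a'', b''⟩ - he
          simpa using he
      have h4 : (a, b) ∈ (cellsUpTo r s (a, b)).filter fun p => T.val p.1 p.2 = c + 1 := by
        simp [mem_cellsUpTo, ha, hb, hc]
      have h5 := Finset.card_erase_lt_of_mem h4
      omega

theorem readingWord_congr {T T' : RectTableau n r s}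
    (h : ∀ a < r, ∀ b < s, T.val a b = T'.val a b) : readingWord T = readingWord T' := by
  rw [readingWord_eq, readingWord_eq]
  refine List.map_congr_left fun p hp => ?_
  rw [mem_readingCells] at hp
  rw [h _ hp.1 _ hp.2]

theorem readingWord_eq_of_highest [Fact (1 < n)] {T T' : RectTableau n r s}
    (h : ∀ c : ℕ, 1 ≤ c → c < n → wordEps n c (readingWord T) = 0)
    (h' : ∀ c : ℕ, 1 ≤ c → c < n → wordEps n c (readingWord T') = 0) :
    readingWord T = readingWord T' :=
  readingWord_congr fun a ha b hb => by
    rw [entry_eq_of_le T le_rfl h ha hb (T.2 a ha b hb).2,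
      entry_eq_of_le T' le_rfl h' ha hb (T'.2 a ha b hb).2]

/-- The shape filled by the letters up to `k` is determined by the content, since row `a` contains
all letters `a + 1` if `a + 1 ≤ k`. -/
theorem entry_le_of_count_eq [Fact (1 < n)] {T T' : RectTableau n r s} {k : ℕ} (hkn : k ≤ n)
    (h : ∀ c : ℕ, 1 ≤ c → c < k → wordEps n c (readingWord T) = 0)
    (h' : ∀ c : ℕ, 1 ≤ c → c < k → wordEps n c (readingWord T') = 0)
    (hcount : ∀ c, (readingWord T).count c = (readingWord T').count c) {a b : ℕ} (ha : a < r)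
    (hb : b < s) (hT : T.val a b ≤ k) : T'.val a b ≤ k := by
  by_contra hT'
  have hak : a + 1 ≤ k := (T.row_lt ha hb).trans hT
  have hc := hcount ((a + 1 : ℕ) : ZMod n)
  rw [count_readingWord T (by omega) (by omega), count_readingWord T' (by omega) (by omega)] at hc
  have h1 : b + 1 ≤
      ((Finset.range r ×ˢ Finset.range s).filter fun p => T.val p.1 p.2 = a + 1).card := by
    rw [← Finset.card_range (b + 1)]
    refine Finset.card_le_card_of_injOn (fun b => (a, b)) (fun b' hb' => ?_)
      fun _ _ _ _ he => by simpa using he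
    have hb' : b' ≤ b := by simpa [Nat.lt_succ_iff] using hb'
    have hle := T.row_weak ha hb' hb
    simp [ha, lt_of_le_of_lt hb' hb,
      entry_eq_of_le T hkn h ha (lt_of_le_of_lt hb' hb) (hle.trans hT)]
  have h2 : ((Finset.range r ×ˢ Finset.range s).filter fun p => T'.val p.1 p.2 = a + 1).card ≤
      b := by
    conv_rhs => rw [← Finset.card_range b]
    have key : ∀ p ∈ (Finset.range r ×ˢ Finset.range s).filter
        fun p => T'.val p.1 p.2 = a + 1, p.1 = a ∧ p.2 < b := by
      rintro ⟨a', b'⟩ hp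
      simp only [Finset.mem_filter, Finset.mem_product, Finset.mem_range] at hp
      obtain ⟨⟨hp1, hp2⟩, hp3⟩ := hp
      have := entry_eq_of_le T' hkn h' hp1 hp2 (by omega)
      obtain rfl : a' = a := by omega
      refine ⟨rfl, ?_⟩
      by_contra hle
      have := T'.row_weak ha (not_lt.1 hle) hp2
      simp only at this
      omega
    refine Finset.card_le_card_of_injOn Prod.snd (fun p hp => ?_) fun p hp q hq he => ?_
    · simpa using (key p hp).2
    · exact Prod.ext ((key p hp).1.trans (key q hq).1.symm) he
  omega

/-- The restriction of the crystal of rectangular tableaux to the colors other than `k` is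
multiplicity free: a highest weight tableau is determined by its content. -/
theorem readingWord_eq_of_count_eq [Fact (1 < n)] {T T' : RectTableau n r s} {k : ℕ} (hkn : k ≤ n)
    (h : ∀ c : ℕ, 1 ≤ c → c < n → c ≠ k → wordEps n c (readingWord T) = 0)
    (h' : ∀ c : ℕ, 1 ≤ c → c < n → c ≠ k → wordEps n c (readingWord T') = 0)
    (hcount : ∀ c, (readingWord T).count c = (readingWord T').count c) :
    readingWord T = readingWord T' := by
  have hl : ∀ c : ℕ, 1 ≤ c → c < k → wordEps n c (readingWord T) = 0 :=
    fun c h1 h2 => h c h1 (by omega) (by omega)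
  have hl' : ∀ c : ℕ, 1 ≤ c → c < k → wordEps n c (readingWord T') = 0 :=
    fun c h1 h2 => h' c h1 (by omega) (by omega)
  have hu : ∀ c : ℕ, k < c → c < n → wordEps n c (readingWord T) = 0 :=
    fun c h1 h2 => h c (by omega) h2 (by omega)
  have hu' : ∀ c : ℕ, k < c → c < n → wordEps n c (readingWord T') = 0 :=
    fun c h1 h2 => h' c (by omega) h2 (by omega)
  refine readingWord_congr fun a ha b hb => ?_
  induction a with
  | zero =>
    by_cases hT : T.val 0 b ≤ k
    · have hT' := entry_le_of_count_eq hkn hl hl' hcount ha hb hT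
      rw [entry_eq_of_le T hkn hl ha hb hT, entry_eq_of_le T' hkn hl' ha hb hT']
    · have hT' : ¬ T'.val 0 b ≤ k := fun hT' =>
        hT (entry_le_of_count_eq hkn hl' hl (fun c => (hcount c).symm) ha hb hT')
      rw [entry_eq_of_lt T hu ha hb (not_le.1 hT), entry_eq_of_lt T' hu' ha hb (not_le.1 hT')]
      simp
  | succ a ih =>
    by_cases hT : T.val (a + 1) b ≤ k
    · have hT' := entry_le_of_count_eq hkn hl hl' hcount ha hb hT
      rw [entry_eq_of_le T hkn hl ha hb hT, entry_eq_of_le T' hkn hl' ha hb hT']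
    · have hT' : ¬ T'.val (a + 1) b ≤ k := fun hT' =>
        hT (entry_le_of_count_eq hkn hl' hl (fun c => (hcount c).symm) ha hb hT')
      rw [entry_eq_of_lt T hu ha hb (not_le.1 hT), entry_eq_of_lt T' hu' ha hb (not_le.1 hT')]
      simp only [Nat.add_sub_cancel, ih (by omega)]

theorem count_readingWord_le [NeZero n] (T : RectTableau n r s) (x : ZMod n) :
    (readingWord T).count x ≤ s := by
  obtain ⟨c, hc, hcn, rfl⟩ : ∃ c : ℕ, 1 ≤ c ∧ c ≤ n ∧ (c : ZMod n) = x := by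
    have hn := NeZero.pos n
    by_cases hx : x = 0
    · exact ⟨n, hn, le_rfl, by simp [hx]⟩
    · exact ⟨x.val, Nat.pos_of_ne_zero ((ZMod.val_ne_zero x).2 hx), x.val_lt.le, by simp⟩
  rw [count_readingWord T hc hcn]
  refine (Finset.card_le_card_of_injOn (t := Finset.range s) Prod.snd (fun p hp => ?_)
    ?_).trans_eq (Finset.card_range s)
  · simp only [Finset.coe_filter, Finset.mem_product, Set.mem_ofPred_eq] at hp
    simpa using hp.1.2
  · rintro ⟨a, b⟩ hp ⟨a', b'⟩ hq he
    simp only [Finset.coe_filter, Finset.mem_product, Finset.mem_range, Set.mem_ofPred_eq] at hp hq he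
    subst he
    rcases lt_trichotomy a a' with hlt | rfl | hlt
    · have := T.col_strict hlt hq.1.1 hq.1.2
      omega
    · rfl
    · have := T.col_strict hlt hp.1.1 hp.1.2
      omega
end

/-! ### Contents and weights -/

theorem wordWt_eq_count (n : ℕ) (w : List (ZMod n)) (i : ZMod n) :
    wordWt n w i = (w.count i : ℤ) - w.count (i + 1) := by
  induction w with
  | nil => simp [wordWt]
  | cons a w ih =>
    have h : i = a - 1 ↔ a = i + 1 := by
      rw [eq_sub_iff_add_eq, eq_comm]
    simp only [wordWt, Pi.add_apply, ih, letterWt, List.count_cons, beq_iff_eq, h,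
      eq_comm (a := i) (b := a)]
    push_cast
    ring

section
variable {n : ℕ}

theorem sum_count_eq_length [NeZero n] (w : List (ZMod n)) : ∑ i, w.count i = w.length := by
  induction w with
  | nil => simp
  | cons a w ih => simp [List.count_cons, Finset.sum_add_distrib, ih]

theorem eq_zero_of_sub_succ_eq_zero [NeZero n] {d : ZMod n → ℤ} (h : ∀ i, d i = d (i + 1))
    (hs : ∑ i, d i = 0) (i : ZMod n) : d i = 0 := by
  have h0 : ∀ m : ℕ, d (m : ZMod n) = d 0 := by
    intro m
    induction m with
    | zero => simp
    | succ m ih => rw [Nat.cast_succ, ← h, ih]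
  have h1 : ∀ i, d i = d 0 := fun i => by
    rw [← h0 i.val, ZMod.natCast_zmod_val]
  rw [Finset.sum_congr rfl fun i _ => h1 i, Finset.sum_const, Finset.card_univ, ZMod.card,
    nsmul_eq_mul, mul_eq_zero] at hs
  rcases hs with hs | hs
  · exact absurd (by exact_mod_cast hs) (NeZero.ne n)
  · rw [h1, hs]

theorem count_eq_of_wordWt_eq_add [NeZero n] {w w' : List (ZMod n)} (hl : w.length = w'.length)
    (i : ZMod n) (hw : wordWt n w' = wordWt n w + simpleRoot n i) (x : ZMod n) :
    (w'.count x : ℤ) = w.count x + (if x = i then 1 else 0) - (if x = i + 1 then 1 else 0) := by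
  have key := eq_zero_of_sub_succ_eq_zero (d := fun x => (w'.count x : ℤ) -
    (w.count x + (if x = i then 1 else 0) - (if x = i + 1 then 1 else 0))) (fun x => ?_) ?_ x
  · omega
  · have h := congrFun hw x
    have h1 : x = i - 1 ↔ x + 1 = i := by rw [eq_sub_iff_add_eq]
    simp only [Pi.add_apply, wordWt_eq_count, simpleRoot, h1, add_left_inj] at h ⊢
    linarith
  · have h1 := sum_count_eq_length w
    have h2 := sum_count_eq_length w'
    simp only [Finset.sum_sub_distrib, Finset.sum_add_distrib, Finset.sum_ite_eq',
      Finset.mem_univ, if_true, ← Nat.cast_sum, h1, h2, hl]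
    ring

/-- A word is determined up to order by its length and its weight, although a weight of level zero
determines the content only up to an additive constant. -/
theorem count_eq_of_wordWt_eq [NeZero n] {w w' : List (ZMod n)} (hl : w.length = w'.length)
    (hw : wordWt n w' = wordWt n w) (x : ZMod n) : w'.count x = w.count x := by
  have key := eq_zero_of_sub_succ_eq_zero (d := fun x => (w'.count x : ℤ) - w.count x)
    (fun x => ?_) ?_ x
  · omega
  · have h := congrFun hw x
    simp only [wordWt_eq_count] at h ⊢
    omega
  · simp only [Finset.sum_sub_distrib, ← Nat.cast_sum, sum_count_eq_length, hl, sub_self]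

/-- For each set of `r` letters there is a tableau of shape `(s^r)` all of whose columns consist of
these letters. -/
theorem exists_rectTableau_count [NeZero n] {r : ℕ} (s : ℕ) (S : Finset (ZMod n))
    (hS : S.card = r) : ∃ T : RectTableau n r s,
      ∀ x, (readingWord T).count x = if x ∈ S then s else 0 := by
  have hn := NeZero.pos n
  -- the letters as numbers between `1` and `n`
  let rep : ZMod n → ℕ := fun x => (x - 1).val + 1
  have hrep : ∀ x, (rep x : ZMod n) = x := fun x => by simp [rep]
  have hinj : Function.Injective rep := fun x y h => by rw [← hrep x, h, hrep]
  have hcard : (S.image rep).card = r := by rw [Finset.card_image_of_injective _ hinj, hS]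
  let g : ℕ → ℕ := fun a => if h : a < r then (S.image rep).orderEmbOfFin hcard ⟨a, h⟩ else 0
  have hg : ∀ a, a < r → ∃ x ∈ S, g a = rep x := by
    intro a ha
    have := Finset.orderEmbOfFin_mem (S.image rep) hcard ⟨a, ha⟩
    rw [Finset.mem_image] at this
    obtain ⟨x, hx, h⟩ := this
    exact ⟨x, hx, by simp [g, ha, h]⟩
  have hmono : ∀ a a', a < a' → a' < r → g a < g a' := by
    intro a a' h h'
    simp only [g, h', h.trans h', dif_pos]
    exact (OrderEmbedding.strictMono _) h
  have hsurj : ∀ x ∈ S, ∃ a < r, g a = rep x := by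
    intro x hx
    have h1 : rep x ∈ Set.range ((S.image rep).orderEmbOfFin hcard) := by
      rw [Finset.range_orderEmbOfFin]
      exact Finset.mem_coe.2 (Finset.mem_image_of_mem _ hx)
    obtain ⟨⟨a, ha⟩, h⟩ := h1
    exact ⟨a, ha, by simp [g, ha, h]⟩
  have hmem : ∀ {a b}, (a, b) ∈ rectDiagram r s ↔ a < r ∧ b < s := by
    intro a b
    rw [← YoungDiagram.mem_cells]
    simp [rectDiagram]
  let T₀ : SemistandardYoungTableau (rectDiagram r s) :=
    { entry := fun a b => if a < r ∧ b < s then g a else 0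
      row_weak' := by
        intro a b b' hb h
        rw [hmem] at h
        rw [if_pos ⟨h.1, hb.trans h.2⟩, if_pos h]
      col_strict' := by
        intro a a' b ha h
        rw [hmem] at h
        rw [if_pos ⟨ha.trans h.1, h.2⟩, if_pos h]
        exact hmono a a' ha h.1
      zeros' := by
        intro a b h
        rw [hmem] at h
        rw [if_neg h] }
  have hT₀ : ∀ a < r, ∀ b < s, T₀ a b = g a := fun a ha b hb => if_pos ⟨ha, hb⟩
  have hT₁ : ∀ a < r, ∀ b < s, 1 ≤ T₀ a b ∧ T₀ a b ≤ n := by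
    intro a ha b hb
    rw [hT₀ a ha b hb]
    obtain ⟨x, -, h⟩ := hg a ha
    have := (x - 1).val_lt
    simp only [h, rep]
    omega
  let T : RectTableau n r s := ⟨T₀, hT₁⟩
  refine ⟨T, fun x => ?_⟩
  have hx1 : 1 ≤ rep x := by simp [rep]
  have hxn : rep x ≤ n := (x - 1).val_lt
  have hcount := count_readingWord T hx1 hxn
  rw [hrep] at hcount
  rw [hcount]
  split_ifs with hx
  · obtain ⟨a, ha, hax⟩ := hsurj x hx
    have : ((Finset.range r ×ˢ Finset.range s).filter fun p => T.val p.1 p.2 = rep x) =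
        {a} ×ˢ Finset.range s := by
      ext ⟨a', b⟩
      simp only [Finset.mem_filter, Finset.mem_product, Finset.mem_range, Finset.mem_singleton]
      constructor
      · rintro ⟨⟨h1, h2⟩, h3⟩
        rw [show T.val a' b = g a' from hT₀ a' h1 b h2, ← hax] at h3
        refine ⟨?_, h2⟩
        rcases lt_trichotomy a a' with h | h | h
        · have := hmono a a' h h1
          omega
        · exact h.symm
        · have := hmono a' a h ha
          omega
      · rintro ⟨rfl, h2⟩
        exact ⟨⟨ha, h2⟩, (hT₀ a' ha b h2).trans hax⟩
    rw [this]
    simp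
  · rw [Finset.card_eq_zero, Finset.filter_eq_empty_iff]
    rintro ⟨a, b⟩ hp h
    simp only [Finset.mem_product, Finset.mem_range] at hp
    obtain ⟨y, hy, hgy⟩ := hg a hp.1
    rw [show T.val a b = g a from hT₀ a hp.1 b hp.2, hgy] at h
    exact hx (hinj h ▸ hy)

/-- The sum of the letters of a word, the letters being numbered from `0` to `n - 1`. It drops
by one under each `e_i` with `i ≠ 0`. -/
def letterSum (w : List (ZMod n)) : ℕ := (w.map fun a => (a - 1).val).sum

theorem letterSum_wordE [Fact (1 < n)] {i : ZMod n} (hi : i ≠ 0) {w y : List (ZMod n)}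
    (h : wordE n i w = some y) : letterSum y < letterSum w := by
  have : NeZero n := ⟨by have : 1 < n := Fact.out; omega⟩
  induction w generalizing y with
  | nil => simp [wordE] at h
  | cons a w ih =>
    rcases (wordE_cons_eq_some _ _ _ _).1 h with ⟨rfl, -, rfl⟩ | ⟨y', hy, rfl, -⟩
    · have h1 : (i - 1).val < i.val := by
        have h2 := Nat.pos_of_ne_zero ((ZMod.val_ne_zero i).2 hi)
        have h3 : i - 1 = ((i.val - 1 : ℕ) : ZMod n) := by
          rw [Nat.cast_sub h2, ZMod.natCast_zmod_val, Nat.cast_one]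
        have h4 : (i - 1).val ≤ i.val - 1 := by
          rw [h3, ZMod.val_natCast]
          exact Nat.mod_le _ _
        omega
      simpa [letterSum] using h1
    · simpa [letterSum] using ih hy
end

/-! ### Kirillov–Reshetikhin crystals -/

section
variable {n r s : ℕ} {B : Type*} {X : CrystalData n B}

/-- The realization of the crystal by rectangular tableaux, for the colors other than `0`. -/
theorem IsKRCrystal.exists_model (hX : IsKRCrystal r s X) : ∃ ψ : B → List (ZMod n),
    Function.Injective ψ ∧ (∀ b, wordWt n (ψ b) = X.wt b) ∧
    (∀ i, i ≠ 0 → ∀ b, wordE n i (ψ b) = (X.e i b).map ψ) ∧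
    (∀ b, ∃ T : RectTableau n r s, readingWord T = ψ b) ∧
    ∀ T : RectTableau n r s, ∃ b, ψ b = readingWord T := by
  obtain ⟨ψ, H, hrange⟩ := hX.classical
  refine ⟨ψ, fun x y h => H.injOn trivial trivial h, fun b => ?_,
    fun i hi b => H.e i hi b trivial, fun b => ?_, fun T => ?_⟩
  · have := H.wt b trivial
    simpa [wordCrystal] using this
  · have : ψ b ∈ Set.range ψ := ⟨b, rfl⟩
    rwa [hrange] at this
  · have : readingWord T ∈ Set.range ψ := by
      rw [hrange]
      exact ⟨T, rfl⟩
    exact this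

/-- A function that decreases along all `e_i` with `i ≠ 0`, for inductions towards highest weight
elements. -/
theorem IsKRCrystal.exists_rank [Fact (1 < n)] (hX : IsKRCrystal r s X) :
    ∃ M : B → ℕ, ∀ i, i ≠ 0 → ∀ b b', X.e i b = some b' → M b' < M b := by
  obtain ⟨ψ, -, -, he, -⟩ := hX.exists_model
  refine ⟨fun b => letterSum (ψ b), fun i hi b b' h => letterSum_wordE hi ?_⟩
  rw [he i hi, h, Option.map_some]

/-- Highest weight elements for the colors other than `0` and `k` are determined by their weight. -/
theorem IsKRCrystal.eq_of_highest_of_wt_eq [Fact (1 < n)] (hX : IsKRCrystal r s X) {k : ℕ}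
    (hk : 1 ≤ k) (hkn : k ≤ n) {b b' : B} (hb : ∀ i, i ≠ 0 → i ≠ (k : ZMod n) → X.e i b = none)
    (hb' : ∀ i, i ≠ 0 → i ≠ (k : ZMod n) → X.e i b' = none) (hwt : X.wt b = X.wt b') :
    b = b' := by
  have : NeZero n := ⟨by omega⟩
  obtain ⟨ψ, hinj, hψ, he, hT, -⟩ := hX.exists_model
  obtain ⟨T, hT₁⟩ := hT b
  obtain ⟨T', hT₂⟩ := hT b'
  have hc : ∀ c : ℕ, 1 ≤ c → c < n → c ≠ k → (c : ZMod n) ≠ 0 ∧ (c : ZMod n) ≠ k :=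
    fun c h1 h2 h3 => ⟨fun h => by
      have := Nat.le_of_dvd h1 ((ZMod.natCast_eq_zero_iff c n).1 h)
      omega, fun h => h3 (natCast_zmod_inj h1 h2.le hk hkn h)⟩
  apply hinj
  rw [← hT₁, ← hT₂]
  refine readingWord_eq_of_count_eq hkn (fun c h1 h2 h3 => ?_) (fun c h1 h2 h3 => ?_) fun c => ?_
  · obtain ⟨h4, h5⟩ := hc c h1 h2 h3
    rw [hT₁, ← wordE_eq_none_iff, he _ h4, hb _ h4 h5, Option.map_none]
  · obtain ⟨h4, h5⟩ := hc c h1 h2 h3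
    rw [hT₂, ← wordE_eq_none_iff, he _ h4, hb' _ h4 h5, Option.map_none]
  · refine count_eq_of_wordWt_eq ?_ ?_ c
    · rw [length_readingWord, length_readingWord]
    · rw [hT₁, hT₂, hψ, hψ, hwt]

/-- The crystal has only one highest weight element for the colors other than `0`. -/
theorem IsKRCrystal.eq_of_highest [Fact (1 < n)] (hX : IsKRCrystal r s X) {b b' : B}
    (hb : ∀ i, i ≠ 0 → X.e i b = none) (hb' : ∀ i, i ≠ 0 → X.e i b' = none) : b = b' := by
  obtain ⟨ψ, hinj, -, he, hT, -⟩ := hX.exists_model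
  obtain ⟨T, hT₁⟩ := hT b
  obtain ⟨T', hT₂⟩ := hT b'
  have hc : ∀ c : ℕ, 1 ≤ c → c < n → (c : ZMod n) ≠ 0 := fun c h1 h2 h => by
    have := Nat.le_of_dvd h1 ((ZMod.natCast_eq_zero_iff c n).1 h)
    omega
  apply hinj
  rw [← hT₁, ← hT₂]
  refine readingWord_eq_of_highest (fun c h1 h2 => ?_) fun c h1 h2 => ?_
  · rw [hT₁, ← wordE_eq_none_iff, he _ (hc c h1 h2), hb _ (hc c h1 h2), Option.map_none]
  · rw [hT₂, ← wordE_eq_none_iff, he _ (hc c h1 h2), hb' _ (hc c h1 h2), Option.map_none]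

/-- The extremal element of content `S`. The operators below would produce an element in which some
letter occurs more than `s` times or a negative number of times. -/
theorem IsKRCrystal.exists_extremal [Fact (1 < n)] (hX : IsKRCrystal r s X) (S : Finset (ZMod n))
    (hS : S.card = r) : ∃ b : B,
      (∀ i, X.wt b i = (if i ∈ S then (s : ℤ) else 0) - if i + 1 ∈ S then (s : ℤ) else 0) ∧
      (∀ i, i ∈ S ∨ i + 1 ∉ S → X.e i b = none) ∧ ∀ i, i + 1 ∈ S ∨ i ∉ S → X.f i b = none := by
  have : NeZero n := ⟨by have : 1 < n := Fact.out; omega⟩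
  obtain ⟨ψ, hinj, hψ, he, hT, hT'⟩ := hX.exists_model
  obtain ⟨T, hcount⟩ := exists_rectTableau_count s S hS
  obtain ⟨b, hb⟩ := hT' T
  rw [← hb] at hcount
  have hlen : ∀ b, (ψ b).length = r * s := fun b => by
    obtain ⟨T, h⟩ := hT b
    rw [← h, length_readingWord]
  have hle : ∀ b x, (ψ b).count x ≤ s := fun b x => by
    obtain ⟨T, h⟩ := hT b
    rw [← h]
    exact count_readingWord_le T x
  refine ⟨b, fun i => ?_, fun i hi => ?_, fun i hi => ?_⟩
  · rw [← hψ, wordWt_eq_count, hcount, hcount]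
    push_cast
    rfl
  · rw [Option.eq_none_iff_forall_ne_some]
    intro b' hb'
    have hwt := hX.isCrystal.wt_e _ _ _ hb'
    rw [← hψ, ← hψ] at hwt
    have h := count_eq_of_wordWt_eq_add ((hlen b).trans (hlen b').symm) i hwt
    have h1 := h i
    have h2 := h (i + 1)
    have h3 := hle b' i
    rw [hcount] at h1 h2
    rcases hi with hi | hi
    · simp [hi] at h1
      omega
    · simp [hi] at h2
  · rw [Option.eq_none_iff_forall_ne_some]
    intro b' hb'
    have hwt := hX.isCrystal.wt_e _ _ _ ((hX.isCrystal.f_iff_e _ _ _).1 hb')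
    rw [← hψ, ← hψ] at hwt
    have h := count_eq_of_wordWt_eq_add ((hlen b').trans (hlen b).symm) i hwt
    have h1 := h i
    have h2 := h (i + 1)
    have h3 := hle b' (i + 1)
    rw [hcount] at h1 h2
    rcases hi with hi | hi
    · simp [hi] at h2
      omega
    · simp [hi] at h1
      omega

/-- An endomorphism of the crystal for the colors other than `0` and `k` is the identity. -/
theorem IsKRCrystal.eq_self_of_comm [Fact (1 < n)] (hX : IsKRCrystal r s X) {k : ℕ}
    (hk : 1 ≤ k) (hkn : k ≤ n) {g : B → B} (hwt : ∀ b, X.wt (g b) = X.wt b)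
    (hg : ∀ i, i ≠ 0 → i ≠ (k : ZMod n) → ∀ b, (X.e i b).map g = X.e i (g b)) (b : B) :
    g b = b := by
  obtain ⟨M, hM⟩ := hX.exists_rank
  induction hm : M b using Nat.strong_induction_on generalizing b with
  | _ m ih =>
    by_cases h : ∀ i, i ≠ 0 → i ≠ (k : ZMod n) → X.e i b = none
    · refine hX.eq_of_highest_of_wt_eq hk hkn (fun i h1 h2 => ?_) h (hwt b)
      rw [← hg i h1 h2, h i h1 h2, Option.map_none]
    · push Not at h
      obtain ⟨i, h1, h2, h3⟩ := h
      obtain ⟨b', hb'⟩ := Option.ne_none_iff_exists'.1 h3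
      have h4 := ih (M b') (hm ▸ hM i h1 b b' hb') b' rfl
      have h5 := hg i h1 h2 b
      rw [hb', Option.map_some, h4, eq_comm, ← hX.isCrystal.f_iff_e] at h5
      rw [← hX.isCrystal.f_iff_e, h5] at hb'
      exact Option.some_injective _ hb'

theorem IsKRCrystal.reachable [Fact (1 < n)] (hX : IsKRCrystal r s X) {u : B}
    (hu : ∀ i, i ≠ 0 → X.e i u = none) (x : B) :
    Relation.ReflTransGen (fun x y => ∃ i, i ≠ 0 ∧ X.f i x = some y) u x := by
  obtain ⟨M, hM⟩ := hX.exists_rank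
  induction hm : M x using Nat.strong_induction_on generalizing x with
  | _ m ih =>
    by_cases h : ∀ i, i ≠ 0 → X.e i x = none
    · rw [hX.eq_of_highest hu h]
    · push Not at h
      obtain ⟨i, h1, h2⟩ := h
      obtain ⟨y, hy⟩ := Option.ne_none_iff_exists'.1 h2
      exact (ih (M y) (hm ▸ hM i h1 x y hy) y rfl).tail
        ⟨i, h1, (hX.isCrystal.f_iff_e _ _ _).2 hy⟩

theorem longestWeyl_involutive (n : ℕ) (k : ZMod n) (lam : ZMod n → ℤ) :
    longestWeyl n k (longestWeyl n k lam) = lam := by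
  ext i
  change - -lam (k - (k - i)) = lam i
  rw [neg_neg, sub_sub_cancel]

/-- The reflection of the affine Dynkin diagram `i ↦ k - i` lifts to the crystal, at the cost of
exchanging raising and lowering operators; the relations for the color `0` are not claimed. -/
theorem IsKRCrystal.exists_reflection [Fact (1 < n)] (hX : IsKRCrystal r s X)
    (hrn : r < n) (k : ZMod n) : ∃ θ : B → B,
      (∀ x, X.wt (θ x) = longestWeyl n k (X.wt x)) ∧
      (∀ i, i ≠ 0 → ∀ x, (X.e i x).map θ = X.f (k - i) (θ x)) ∧
      ∀ i, i ≠ 0 → ∀ x, (X.f i x).map θ = X.e (k - i) (θ x) := by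
  let S : Finset (ZMod n) := (Finset.range r).image fun a => ((a + 1 : ℕ) : ZMod n)
  have hS : S.card = r := by
    rw [Finset.card_image_of_injOn, Finset.card_range]
    intro a ha b hb h
    simp only [Finset.coe_range, Set.mem_Iio] at ha hb
    have := natCast_zmod_inj (n := n) (by omega) (by omega) (by omega) (by omega) h
    omega
  let S' : Finset (ZMod n) := S.image fun x => k + 1 - x
  have hS' : S'.card = r := by
    rw [Finset.card_image_of_injective _ sub_right_injective, hS]
  have hmem : ∀ x, x ∈ S' ↔ k + 1 - x ∈ S := by
    intro x
    simp only [S', Finset.mem_image]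
    constructor
    · rintro ⟨y, hy, rfl⟩
      rwa [sub_sub_cancel]
    · intro h
      exact ⟨_, h, sub_sub_cancel _ _⟩
  -- the letters of `S` other than `1` have their predecessor in `S`
  have hpred : ∀ x, x ≠ 0 → x + 1 ∈ S → x ∈ S := by
    intro x hx h
    simp only [S, Finset.mem_image, Finset.mem_range] at h ⊢
    obtain ⟨a, ha, h⟩ := h
    rw [Nat.cast_succ, add_left_inj] at h
    subst h
    cases a with
    | zero => simp at hx
    | succ a => exact ⟨a, by omega, rfl⟩
  obtain ⟨u, hu, hue, -⟩ := hX.exists_extremal S hS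
  obtain ⟨v, hv, -, hvf⟩ := hX.exists_extremal S' hS'
  have hu₀ : ∀ i, i ≠ 0 → X.e i u = none := fun i hi => hue i <| by
    by_contra! h
    exact h.1 (hpred i hi h.2)
  refine IsRegularCrystal.exists_reflection hX.isCrystal hX.isRegular hu₀ (y₀ := v)
    (fun i hi => hvf i ?_) ?_ (hX.reachable hu₀)
  · by_contra! h
    rw [hmem, hmem] at h
    apply h.1
    rw [show k + 1 - (i + 1) = k - i by ring]
    exact hpred _ (fun h => hi (sub_eq_zero.1 h).symm) (by
      rw [show k - i + 1 = k + 1 - i by ring]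
      exact h.2)
  · ext i
    change X.wt v i = -X.wt u (k - i)
    rw [hu, hv]
    simp only [hmem, show k + 1 - (i + 1) = k - i by ring, show k - i + 1 = k + 1 - i by ring]
    ring
end

theorem mainTheorem7 {B : Type*} (n r s : ℕ) (hr : 1 ≤ r) (hrn : r ≤ n - 1) (hs : 1 ≤ s)
    (X : CrystalData n B) (hX : IsKRCrystal r s X) (k : ℕ) (hk : 1 ≤ k) (hkn : k ≤ n - 1) :
    (∃! η : B → B, IsLusztigInvolution X (k : ZMod n) η) ∧
    ∀ η : B → B, IsLusztigInvolution X (k : ZMod n) η →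
      (∀ b, X.e 0 b = (X.f (k : ZMod n) (η b)).map η) ∧
      (∀ b, X.f 0 b = (X.e (k : ZMod n) (η b)).map η) := by
  have : Fact (1 < n) := ⟨by omega⟩
  have hk0 : (k : ZMod n) ≠ 0 := fun h => by
    have := Nat.le_of_dvd hk ((ZMod.natCast_eq_zero_iff k n).1 h)
    omega
  obtain ⟨θ, hwt, he, hf⟩ := hX.exists_reflection (by omega) (k : ZMod n)
  -- a Lusztig involution followed by `θ` is an endomorphism for the colors other than `0` and `k`
  have key : ∀ η : B → B, (∀ b, X.wt (η b) = longestWeyl n k (X.wt b)) →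
      (∀ i, i ≠ 0 → i ≠ (k : ZMod n) → ∀ b, (X.e i b).map η = X.f (k - i) (η b)) →
      ∀ b, θ (η b) = b := fun η h1 h2 =>
    hX.eq_self_of_comm hk (by omega) (g := fun b => θ (η b))
      (fun b => by rw [hwt, h1, longestWeyl_involutive]) fun i hi hik b => by
        have h3 := hf (k - i) (sub_ne_zero.2 hik.symm) (η b)
        rw [← h2 i hi hik, Option.map_map, sub_sub_cancel] at h3
        exact h3
  have hθ : ∀ b, θ (θ b) = b := key θ hwt fun i hi _ => he i hi
  have hL : IsLusztigInvolution X (k : ZMod n) θ :=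
    ⟨hθ, hwt, fun i hi _ => he i hi, fun i hi _ => hf i hi⟩
  have huniq : ∀ η : B → B, IsLusztigInvolution X (k : ZMod n) η → η = θ := by
    intro η hη
    funext b
    have := key η hη.wt hη.e b
    rw [← hθ (η b), this]
  refine ⟨⟨θ, hL, huniq⟩, fun η hη => ?_⟩
  rw [huniq η hη]
  constructor
  · intro b
    rw [hf k hk0, sub_self, hθ]
  · intro b
    rw [he k hk0, sub_self, hθ]
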